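/- **Setting.** Fix a field $F$, a homology degree $d\ge 0$ and a real $p\ge 1$. For a finite metric space $S$ and $r\in\mathbb{R}$ let $\mathrm{VR}(S,r)$ be the simplicial complex of nonempty subsets of $S$ of diameter less than $r$. Let $D[S]$ be the persistence diagram of the persistence module $r\mapsto H_d(\mathrm{VR}(S,r);F)$, regarded as a measure on $\Omega=\{(x,y)\in\mathbb{R}^2: x<y\}$: the sum of Dirac masses at its points (birth, death) with finite death, counted with multiplicity. With $\overline\Omega=\{x\le y\}$, put for measures $\mu,\nu$ on $\Omega$ $$\mathrm{OT}_p(\mu,\nu)=\inf_{\Pi}\Big(\int_{\overline\Omega\times\overline\Omega}\|x-y\|_p^p\,d\Pi(x,y)\Big)^{1/p},$$ where $\Pi$ ranges over the Radon measures on $\overline\Omega\times\overline\Omega$ with $\Pi(P\times\overline\Omega)=\mu(P)$ and $\Pi(\overline\Omega\times Q)=\nu(Q)$ for all Borel $P,Q\subseteq\Omega$. A probability measure $\pi$ on a metric space $\mathcal X$ satisfies the $(a,b,r_0)$-standard assumption, where $a,b>0$ and $r_0\ge 0$, if $\pi(\mathcal B(x,r))\ge\min(1,ar^b)$ for all $x\in\mathcal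 X$ and $r>r_0$. **Theorem.** Let $N\in\mathbb{N}$. There are a constant $C_2$, depending only on $F,d,p,N$, and constants $C_3=C_3(a,b)$, depending only on $F,d,p,N,a,b$, and for every $m$ and every set $\mathcal X\subset\mathbb{R}^m$ of $N$ points there is a constant $C_1$, depending only on $F,d,p,\mathcal X$, such that the following holds. Let $\pi$ be a probability measure on $\mathcal X$ satisfying the $(a,b,r_0)$-standard assumption, let $n,B\ge 1$, let $S_n^{(1)},\dots,S_n^{(B)}$ be i.i.d. samples from $\pi^{\otimes n}$, and let $\bar D=\frac1B\sum_{i=1}^B D[S_n^{(i)}]$, where $S_n^{(i)}$ is viewed as the set of its points. Put $\beta=\frac pb-1$. Then $$\mathbb{E}\big[\mathrm{OT}_p^p(\bar D,D[\mathcal X])\big]\le C_1B^{-1/2}+C_2\,r_0^p+C_3\,\rho_n,$$ where $$\rho_n=\begin{cases} n^{-\beta} & \text{if } p>b,\\[2pt] \big(\frac{\log n}{n}\big)^{1/b} & \text{if } p\le b,\ n\ge 2,\ r_0<\big(\frac{\log n}{an}\big)^{1/b},\\[2pt] \big(\frac{\log n}{n}\big)^{p/b}\frac{1}{(\log n)^2}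 & \text{if } p\le b,\ n\ge 2,\ r_0\ge\big(\frac{\log n}{an}\big)^{1/b}.\end{cases}$$ -/

import Mathlib

open MeasureTheory ProbabilityTheory
open scoped ENNReal

noncomputable section

namespace MeanPersistence

/-! ### Simplicial homology -/

section Homology

variable (F : Type*) [Field F] {V : Type*}

/-- Ordered `d`-chains on the vertex set `V`: formal combinations of `(d+1)`-tuples of vertices. -/
abbrev Chain (V : Type*) (d : ℕ) : Type _ := (Fin (d + 1) → V) →₀ F

/-- The boundary `∂ (v₀, …, v_{d+1}) = ∑ᵢ (-1)ⁱ (v₀, …, v̂ᵢ, …, v_{d+1})`. -/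
def boundary (V : Type*) (d : ℕ) : Chain F V (d + 1) →ₗ[F] Chain F V d :=
  Finsupp.linearCombination F fun σ : Fin (d + 2) → V =>
    ∑ i : Fin (d + 2), (-1 : F) ^ (i : ℕ) • Finsupp.single (σ ∘ i.succAbove) (1 : F)

/-- The ordered `d`-simplices of a simplicial complex: tuples whose vertices span a face. -/
def orderedSimplices (K : PreAbstractSimplicialComplex V) (d : ℕ) : Set (Fin (d + 1) → V) :=
  {σ | ∃ s ∈ K.faces, (s : Set V) = Set.range σ}

/-- The ordered chains of a simplicial complex. -/
def chains (K : PreAbstractSimplicialComplex V) (d : ℕ) : Submodule F (Chain F V d) :=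
  Finsupp.supported F F (orderedSimplices K d)

/-- The `d`-cycles of a simplicial complex (unreduced: every `0`-chain is a cycle). -/
def cycles (K : PreAbstractSimplicialComplex V) : (d : ℕ) → Submodule F (Chain F V d)
  | 0 => chains F K 0
  | d + 1 => chains F K (d + 1) ⊓ LinearMap.ker (boundary F V d)

/-- The `d`-boundaries of a simplicial complex. -/
def boundaries (K : PreAbstractSimplicialComplex V) (d : ℕ) : Submodule F (Chain F V d) :=
  (chains F K (d + 1)).map (boundary F V d)

/-- The simplicial homology `H_d(K; F) = Z_d / B_d`, computed from the ordered chain complex and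
realized as the image of the cycles in the quotient of the chain space by the boundaries. -/
abbrev Homology (K : PreAbstractSimplicialComplex V) (d : ℕ) :
    Submodule F (Chain F V d ⧸ boundaries F K d) :=
  (cycles F K d).map (boundaries F K d).mkQ

variable {K L : PreAbstractSimplicialComplex V}

theorem chains_mono (h : K ≤ L) (d : ℕ) : chains F K d ≤ chains F L d :=
  Finsupp.supported_mono fun _ ⟨s, hs, e⟩ => ⟨s, h hs, e⟩

theorem cycles_mono (h : K ≤ L) : ∀ d : ℕ, cycles F K d ≤ cycles F L d
  | 0 => chains_mono F h 0
  | d + 1 => inf_le_inf_right _ (chains_mono F h (d + 1))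

theorem boundaries_mono (h : K ≤ L) (d : ℕ) : boundaries F K d ≤ boundaries F L d :=
  Submodule.map_mono (chains_mono F h (d + 1))

/-- The map `H_d(K) → H_d(L)` induced by an inclusion of complexes `K ≤ L`. -/
def homologyMap (h : K ≤ L) (d : ℕ) : Homology F K d →ₗ[F] Homology F L d :=
  (Submodule.factor (boundaries_mono F h d)).restrict (by
    rintro _ ⟨x, hx, rfl⟩
    exact ⟨x, cycles_mono F h d hx, rfl⟩)

end Homology

/-! ### Persistence diagrams of Vietoris–Rips filtrations -/

section Rips

/-- The Vietoris–Rips complex at scale `r`: nonempty finite sets of points of diameter less than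
`r`. -/
def ripsComplex (V : Type*) [MetricSpace V] (r : ℝ) : PreAbstractSimplicialComplex V where
  faces := {s | s.Nonempty ∧ Metric.diam (s : Set V) < r}
  isRelLowerSet_faces := fun s hs => ⟨hs.1, fun _ hts ht =>
    ⟨ht, (Metric.diam_mono (Finset.coe_subset.2 hts) s.finite_toSet.isBounded).trans_lt hs.2⟩⟩

theorem ripsComplex_mono (V : Type*) [MetricSpace V] {s t : ℝ} (h : s ≤ t) :
    ripsComplex V s ≤ ripsComplex V t :=
  fun _ hx => ⟨hx.1, hx.2.trans_le h⟩

variable (F : Type*) [Field F] (d : ℕ) (V : Type*) [MetricSpace V]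

/-- The persistent Betti number: the rank of `H_d(VR(V, s)) → H_d(VR(V, t))`, for `s ≤ t`. -/
def persistentBetti (s t : ℝ) : ℕ :=
  if h : s ≤ t then
    Module.finrank F (LinearMap.range (homologyMap F (ripsComplex_mono V h) d))
  else 0

/-- For `a < b < c < e`, the number of classes born between `a` and `b` and dying between `c` and
`e`, obtained from the persistent Betti numbers by inclusion and exclusion. -/
def rectangleCount (a b c e : ℝ) : ℤ :=
  (persistentBetti F d V b c - persistentBetti F d V a c : ℤ)
    - (persistentBetti F d V b e - persistentBetti F d V a e)

/-- The multiplicity of the point `(s, t)`, `s < t`, in the persistence diagram: the smallest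
number of classes counted by a rectangle around `(s, t)`. -/
def multiplicity (z : ℝ × ℝ) : ℕ :=
  sInf {k : ℕ | ∃ a b c e : ℝ, a < z.1 ∧ z.1 < b ∧ b < c ∧ c < z.2 ∧ z.2 < e ∧
    (k : ℤ) = rectangleCount F d V a b c e}

end Rips

/-- The open half-plane `Ω` above the diagonal. -/
def halfPlane : Set (ℝ × ℝ) := {z | z.1 < z.2}

/-- The closed half-plane `Ω ∪ ∂Ω`. -/
def closedHalfPlane : Set (ℝ × ℝ) := {z | z.1 ≤ z.2}

/-- The degree-`d` persistence diagram `D[S]` of the Vietoris–Rips filtration of a set of points,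
as a measure carried by `Ω`: the sum of the Dirac masses at its off-diagonal points, counted with
multiplicity. Classes that never die are not recorded. -/
def diagram (F : Type*) [Field F] (d : ℕ) {E : Type*} [MetricSpace E] (S : Set E) :
    Measure (ℝ × ℝ) :=
  Measure.sum fun z : halfPlane =>
    (multiplicity F d S (z : ℝ × ℝ) : ℝ≥0∞) • Measure.dirac (z : ℝ × ℝ)

/-! ### Optimal partial transport -/

/-- Admissible plans for the optimal partial transport between measures `μ`, `ν` on `Ω`: Radon
measures on `Ω̄ × Ω̄` whose marginals agree with `μ` and `ν` on the Borel subsets of `Ω`. -/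
structure IsPartialPlan (μ ν : Measure (ℝ × ℝ)) (γ : Measure ((ℝ × ℝ) × (ℝ × ℝ))) : Prop where
  locallyFinite : IsLocallyFiniteMeasure γ
  carried : γ (closedHalfPlane ×ˢ closedHalfPlane)ᶜ = 0
  left : ∀ P ⊆ halfPlane, MeasurableSet P → γ (P ×ˢ closedHalfPlane) = μ P
  right : ∀ Q ⊆ halfPlane, MeasurableSet Q → γ (closedHalfPlane ×ˢ Q) = ν Q

/-- The cost `‖x - y‖_p ^ p` on the plane with the `p`-norm. -/
def cost (p : ℝ) (x y : ℝ × ℝ) : ℝ := |x.1 - y.1| ^ p + |x.2 - y.2| ^ p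

/-- The optimal partial transport distance `OT_p`, with ground norm the `p`-norm. -/
def OT (p : ℝ) (μ ν : Measure (ℝ × ℝ)) : ℝ≥0∞ :=
  ⨅ (γ : Measure ((ℝ × ℝ) × (ℝ × ℝ))) (_ : IsPartialPlan μ ν γ),
    (∫⁻ w, ENNReal.ofReal (cost p w.1 w.2) ∂γ) ^ (1 / p)

/-! ### Sampling -/

/-- The `(a, b, r₀)`-standard assumption on a measure. -/
structure StandardAssumption {M : Type*} [PseudoMetricSpace M] [MeasurableSpace M]
    (π : Measure M) (a b r₀ : ℝ) : Prop where
  a_pos : 0 < a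
  b_pos : 0 < b
  r₀_nonneg : 0 ≤ r₀
  le_measure_ball : ∀ (x : M) (r : ℝ), r₀ < r →
    ENNReal.ofReal (min 1 (a * r ^ b)) ≤ π (Metric.ball x r)

/-- The mean persistence measure `D̄ = B⁻¹ ∑ᵢ D[Sᵢ]` of `B` samples of `n` points, where `D[Sᵢ]`
is the diagram of the set of points of the `i`-th sample. -/
def meanMeasure (F : Type*) [Field F] (d : ℕ) {E : Type*} [MetricSpace E] {B n : ℕ}
    (S : Fin B → Fin n → E) : Measure (ℝ × ℝ) :=
  (B : ℝ≥0∞)⁻¹ • ∑ i, diagram F d (Set.range (S i))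

/-- The approximation error `𝔼[OT_p(D̄, D[X]) ^ p]` for random samples `S` of points of `X`. -/
def approximationError (F : Type*) [Field F] (d : ℕ) (p : ℝ) {E : Type*} [MetricSpace E]
    (X : Finset E) {Ω : Type*} [MeasurableSpace Ω] (P : Measure Ω) {B n : ℕ}
    (S : Fin B → Ω → Fin n → X) : ℝ≥0∞ :=
  ∫⁻ ω, OT p (meanMeasure F d fun i j => (S i ω j : E)) (diagram F d (X : Set E)) ^ p ∂P

end MeanPersistence

end

/-! Partial transport cost is convex: averaging plans from each `D[Sᵢ]` to `D[X]` gives a plan from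
the mean measure (`IsPartialPlan.mean`). The error is thus controlled by that of one sample,
whatever `B` is. Two estimates remain.

Stability (`exists_isPartialPlan_diagram`). If `S ⊆ X` is `ε`-dense, a retraction of `X` onto `S`
moves points by at most `ε` and interleaves the two Rips filtrations up to `2ε`. So persistent Betti
numbers agree at scales followed by `2ε` without critical values
(`persistentBetti_eq_of_retraction`). Cut the line at such a scale in every gap of length at least
`3ε` between distances of `X`. Rectangles bounded by cuts and lying above the diagonal then have
equal mass in both diagrams, so mass can be moved within rectangles, or to the diagonal in those
that meet it; no matching of diagram points is needed. Distances not separated by a cut differ by at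
most `3ε N²`, and total masses are bounded in terms of `N` and `d`, so the cost is `O(ε ^ p)`.

Covering radius (`lintegral_coveringRadius_rpow_le`). A union bound gives the tail `N exp(-a n r ^
b)` for `r > r₀`, hence a `p`-th moment at most `r₀ ^ p + const · n ^ (-p/b) · exp(-a n r₀ ^ b /
2)`. It remains to compare with the three rates; only the last one needs the exponential factor. -/

noncomputable section

namespace MeanPersistence

/-! ### Contiguity in ordered simplicial homology

The homotopy formulas are uniform in the augmented complex, where `n`-tuples of vertices sit in
degree `n - 1`. -/

section Prism

variable (F : Type*) [Field F] {V W : Type*}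

/-- The boundary of the augmented ordered chain complex, on `(n+1)`-tuples. -/
def augBoundary (V : Type*) (n : ℕ) : ((Fin (n + 1) → V) →₀ F) →ₗ[F] ((Fin n → V) →₀ F) :=
  Finsupp.linearCombination F fun σ : Fin (n + 1) → V =>
    ∑ i : Fin (n + 1), (-1 : F) ^ (i : ℕ) • Finsupp.single (σ ∘ i.succAbove) (1 : F)

theorem boundary_eq_augBoundary (V : Type*) (d : ℕ) :
    boundary F V d = augBoundary F V (d + 1) := rfl

/-- Prepending the vertex `v`. -/
def cone (v : V) (n : ℕ) : ((Fin n → V) →₀ F) →ₗ[F] ((Fin (n + 1) → V) →₀ F) :=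
  Finsupp.lmapDomain F F fun σ => (Fin.cons v σ : Fin (n + 1) → V)

/-- The chain map induced by a map of vertices. -/
def push (f : V → W) (n : ℕ) : ((Fin n → V) →₀ F) →ₗ[F] ((Fin n → W) →₀ F) :=
  Finsupp.lmapDomain F F fun σ => f ∘ σ

@[simp]
theorem cone_single (v : V) (n : ℕ) (σ : Fin n → V) (c : F) :
    cone F v n (Finsupp.single σ c) = Finsupp.single (Fin.cons v σ : Fin (n + 1) → V) c := by
  simp [cone]

@[simp]
theorem push_single (f : V → W) (n : ℕ) (σ : Fin n → V) (c : F) :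
    push F f n (Finsupp.single σ c) = Finsupp.single (f ∘ σ) c := by
  simp [push]

theorem augBoundary_single (n : ℕ) (σ : Fin (n + 1) → V) :
    augBoundary F V n (Finsupp.single σ 1) =
      ∑ i : Fin (n + 1), (-1 : F) ^ (i : ℕ) • Finsupp.single (σ ∘ i.succAbove) (1 : F) := by
  simp [augBoundary]

theorem cons_comp_succ_succAbove (n : ℕ) (v : V) (σ : Fin (n + 1) → V) (i : Fin (n + 1)) :
    (Fin.cons v σ : Fin (n + 2) → V) ∘ i.succ.succAbove = Fin.cons v (σ ∘ i.succAbove) := by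
  funext j
  refine Fin.cases ?_ (fun j => ?_) j <;> simp

theorem augBoundary_cone_zero (v : V) (x : (Fin 0 → V) →₀ F) :
    augBoundary F V 0 (cone F v 0 x) = x := by
  suffices h : augBoundary F V 0 ∘ₗ cone F v 0 = LinearMap.id from LinearMap.congr_fun h x
  ext σ : 2
  simp only [LinearMap.comp_apply, Finsupp.lsingle_apply, cone_single, augBoundary_single,
    LinearMap.id_apply]
  simp [Subsingleton.elim _ (default : Fin 0 → V)]

/-- Face `0` deletes `v`; every other face commutes with prepending `v`, its sign shifted by one. -/
theorem augBoundary_cone_succ (v : V) (n : ℕ) (x : (Fin (n + 1) → V) →₀ F) :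
    augBoundary F V (n + 1) (cone F v (n + 1) x) = x - cone F v n (augBoundary F V n x) := by
  suffices h : augBoundary F V (n + 1) ∘ₗ cone F v (n + 1) =
      LinearMap.id - cone F v n ∘ₗ augBoundary F V n from LinearMap.congr_fun h x
  ext σ : 2
  simp only [LinearMap.comp_apply, Finsupp.lsingle_apply, cone_single, augBoundary_single,
    LinearMap.id_apply, LinearMap.sub_apply, map_sum, map_smul]
  rw [Fin.sum_univ_succ]
  simp only [cons_comp_succ_succAbove, Fin.val_succ, pow_succ, Fin.val_zero, pow_zero, one_smul,
    mul_neg, mul_one, neg_smul, Finset.sum_neg_distrib, ← sub_eq_add_neg]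
  congr 2

theorem augBoundary_push (f : V → W) (n : ℕ) (x : (Fin (n + 1) → V) →₀ F) :
    augBoundary F W n (push F f (n + 1) x) = push F f n (augBoundary F V n x) := by
  suffices h : augBoundary F W n ∘ₗ push F f (n + 1) = push F f n ∘ₗ augBoundary F V n from
    LinearMap.congr_fun h x
  ext σ : 2
  simp only [LinearMap.comp_apply, Finsupp.lsingle_apply, push_single, augBoundary_single, map_sum,
    map_smul, Function.comp_assoc]

theorem push_cone (f : V → W) (v : V) (n : ℕ) (x : (Fin n → V) →₀ F) :
    push F f (n + 1) (cone F v n x) = cone F (f v) n (push F f n x) := by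
  suffices h : push F f (n + 1) ∘ₗ cone F v n = cone F (f v) n ∘ₗ push F f n from
    LinearMap.congr_fun h x
  ext σ : 2
  simp only [LinearMap.comp_apply, Finsupp.lsingle_apply, push_single, cone_single]
  congr 1
  funext j
  refine Fin.cases ?_ (fun j => ?_) j <;> simp

/-- The prism over an ordered simplex, between its images under `f` and `g`. -/
def prismSimplex (f g : V → W) : (n : ℕ) → (Fin n → V) → ((Fin (n + 1) → W) →₀ F)
  | 0, _ => 0
  | n + 1, σ => cone F (f (σ 0)) (n + 1)
      (cone F (g (σ 0)) n (Finsupp.single (g ∘ Fin.tail σ) 1) - prismSimplex f g n (Fin.tail σ))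

/-- The prism operator, a chain homotopy between the maps induced by `f` and `g`. -/
def prism (f g : V → W) (n : ℕ) : ((Fin n → V) →₀ F) →ₗ[F] ((Fin (n + 1) → W) →₀ F) :=
  Finsupp.linearCombination F (prismSimplex F f g n)

theorem prism_cone (f g : V → W) (v : V) (n : ℕ) (x : (Fin n → V) →₀ F) :
    prism F f g (n + 1) (cone F v n x) =
      cone F (f v) (n + 1) (cone F (g v) n (push F g n x) - prism F f g n x) := by
  suffices h : prism F f g (n + 1) ∘ₗ cone F v n =
      cone F (f v) (n + 1) ∘ₗ (cone F (g v) n ∘ₗ push F g n - prism F f g n) from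
    LinearMap.congr_fun h x
  ext σ : 2
  simp [prism, prismSimplex]

/-- Induction on the number of vertices. With a simplex written as a cone, `prism_cone` and the cone
formula reduce the identity to the one for the remaining vertices, so no alternating sum is handled.
The prism over the empty tuple is zero, and `f` and `g` agree there. -/
theorem augBoundary_prism (f g : V → W) (n : ℕ) (x : (Fin (n + 1) → V) →₀ F) :
    augBoundary F W (n + 1) (prism F f g (n + 1) x) + prism F f g n (augBoundary F V n x) =
      push F g (n + 1) x - push F f (n + 1) x := by
  suffices h : augBoundary F W (n + 1) ∘ₗ prism F f g (n + 1) + prism F f g n ∘ₗ augBoundary F V n =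
      push F g (n + 1) - push F f (n + 1) from LinearMap.congr_fun h x
  clear x
  induction n with
  | zero =>
    ext σ : 2
    obtain ⟨v, τ, rfl⟩ : ∃ v τ, σ = Fin.cons v τ := ⟨σ 0, Fin.tail σ, (Fin.cons_self_tail σ).symm⟩
    have h0 : prism F f g 0 = 0 := by
      ext σ : 2
      simp [prism, prismSimplex]
    simp only [LinearMap.comp_apply, Finsupp.lsingle_apply, LinearMap.add_apply,
      LinearMap.sub_apply]
    rw [← cone_single F v 0 τ 1, prism_cone, h0, augBoundary_cone_succ, push_cone, push_cone]
    simp only [LinearMap.zero_apply, sub_zero, add_zero, augBoundary_cone_zero, push_single]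
    rw [Subsingleton.elim (g ∘ τ) (f ∘ τ)]
  | succ n ih =>
    ext σ : 2
    obtain ⟨v, τ, rfl⟩ : ∃ v τ, σ = Fin.cons v τ := ⟨σ 0, Fin.tail σ, (Fin.cons_self_tail σ).symm⟩
    simp only [LinearMap.comp_apply, Finsupp.lsingle_apply, LinearMap.add_apply,
      LinearMap.sub_apply]
    rw [← cone_single F v (n + 1) τ 1]
    generalize Finsupp.single τ (1 : F) = y
    have hy := LinearMap.congr_fun ih y
    simp only [LinearMap.comp_apply, LinearMap.add_apply, LinearMap.sub_apply] at hy
    rw [← eq_sub_iff_add_eq] at hy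
    rw [prism_cone, augBoundary_cone_succ, augBoundary_cone_succ, map_sub, map_sub,
      augBoundary_cone_succ, augBoundary_push, hy, push_cone, push_cone]
    simp only [map_sub, prism_cone]
    abel

end Prism

/-! ### Homology under contiguous simplicial maps. -/

section Contiguity

variable (F : Type*) [Field F] {V W : Type*}

theorem mem_supported_of_push {f : V → W} {n : ℕ} {A : Set (Fin n → V)} {B : Set (Fin n → W)}
    (h : ∀ σ ∈ A, f ∘ σ ∈ B) {x : (Fin n → V) →₀ F} (hx : x ∈ Finsupp.supported F F A) :
    push F f n x ∈ Finsupp.supported F F B := by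
  rw [Finsupp.supported_eq_span_single] at hx
  induction hx using Submodule.span_induction with
  | mem x hx =>
    obtain ⟨σ, hσ, rfl⟩ := hx
    rw [push_single]
    exact Finsupp.single_mem_supported F _ (h σ hσ)
  | zero => simp
  | add x y _ _ hx hy => rw [map_add]; exact add_mem hx hy
  | smul a x _ hx => rw [map_smul]; exact Submodule.smul_mem _ _ hx

theorem mem_supported_of_cone {v : V} {n : ℕ} {A : Set V} (hv : v ∈ A) {x : (Fin n → V) →₀ F}
    (hx : x ∈ Finsupp.supported F F {σ : Fin n → V | Set.range σ ⊆ A}) :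
    cone F v n x ∈ Finsupp.supported F F {σ : Fin (n + 1) → V | Set.range σ ⊆ A} := by
  rw [Finsupp.supported_eq_span_single] at hx
  induction hx using Submodule.span_induction with
  | mem x hx =>
    obtain ⟨σ, hσ, rfl⟩ := hx
    rw [cone_single]
    refine Finsupp.single_mem_supported F _ ?_
    rintro _ ⟨j, rfl⟩
    refine Fin.cases ?_ (fun j => ?_) j
    · simpa using hv
    · simpa using hσ ⟨j, rfl⟩
  | zero => simp
  | add x y _ _ hx hy => rw [map_add]; exact add_mem hx hy
  | smul a x _ hx => rw [map_smul]; exact Submodule.smul_mem _ _ hx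

theorem prismSimplex_mem_supported (f g : V → W) (n : ℕ) (σ : Fin n → V) {A : Set W}
    (hf : ∀ j, f (σ j) ∈ A) (hg : ∀ j, g (σ j) ∈ A) :
    prismSimplex F f g n σ ∈ Finsupp.supported F F {τ : Fin (n + 1) → W | Set.range τ ⊆ A} := by
  induction n with
  | zero => exact Submodule.zero_mem _
  | succ n ih =>
    refine mem_supported_of_cone F (hf 0) (sub_mem (mem_supported_of_cone F (hg 0) ?_)
      (ih _ (fun j => hf j.succ) fun j => hg j.succ))
    refine Finsupp.single_mem_supported F _ ?_
    rintro _ ⟨j, rfl⟩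
    exact hg j.succ

variable {F}

theorem push_mem_chains {K : PreAbstractSimplicialComplex V} {L : PreAbstractSimplicialComplex W}
    {f : V → W} (h : ∀ s ∈ K.faces, ∃ t ∈ L.faces, (t : Set W) = f '' s) {d : ℕ}
    {x : Chain F V d} (hx : x ∈ chains F K d) : push F f (d + 1) x ∈ chains F L d := by
  refine mem_supported_of_push F ?_ hx
  rintro σ ⟨s, hs, e⟩
  obtain ⟨t, ht, e'⟩ := h s hs
  exact ⟨t, ht, by rw [e', e, Set.range_comp]⟩

theorem push_mem_cycles {K : PreAbstractSimplicialComplex V} {L : PreAbstractSimplicialComplex W}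
    {f : V → W} (h : ∀ s ∈ K.faces, ∃ t ∈ L.faces, (t : Set W) = f '' s) {d : ℕ}
    {x : Chain F V d} (hx : x ∈ cycles F K d) : push F f (d + 1) x ∈ cycles F L d := by
  cases d with
  | zero => exact push_mem_chains h hx
  | succ d =>
    refine ⟨push_mem_chains h hx.1, ?_⟩
    have h2 := hx.2
    simp only [SetLike.mem_coe, LinearMap.mem_ker, boundary_eq_augBoundary] at h2 ⊢
    rw [augBoundary_push, h2, map_zero]

theorem push_mem_boundaries {K : PreAbstractSimplicialComplex V}
    {L : PreAbstractSimplicialComplex W} {f : V → W}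
    (h : ∀ s ∈ K.faces, ∃ t ∈ L.faces, (t : Set W) = f '' s) {d : ℕ}
    {x : Chain F V d} (hx : x ∈ boundaries F K d) : push F f (d + 1) x ∈ boundaries F L d := by
  obtain ⟨y, hy, rfl⟩ := hx
  exact ⟨push F f (d + 2) y, push_mem_chains h hy, augBoundary_push F f (d + 1) y⟩

/-- Contiguous maps agree on homology. -/
theorem push_sub_push_mem_boundaries {K : PreAbstractSimplicialComplex V}
    {L : PreAbstractSimplicialComplex W} {f g : V → W}
    (h : ∀ s ∈ K.faces, ∃ t ∈ L.faces, (t : Set W) = f '' s ∪ g '' s) {d : ℕ}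
    {x : Chain F V d} (hx : x ∈ cycles F K d) :
    push F g (d + 1) x - push F f (d + 1) x ∈ boundaries F L d := by
  have hprism : ∀ x ∈ chains F K d, prism F f g (d + 1) x ∈ chains F L (d + 1) := by
    intro x hx
    rw [chains, Finsupp.supported_eq_span_single] at hx
    induction hx using Submodule.span_induction with
    | mem x hx =>
      obtain ⟨σ, ⟨s, hs, e⟩, rfl⟩ := hx
      obtain ⟨t, ht, e'⟩ := h s hs
      have hm := prismSimplex_mem_supported F f g (d + 1) σ (A := (t : Set W))
        (fun j => by rw [e', e]; exact Or.inl ⟨σ j, ⟨j, rfl⟩, rfl⟩)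
        (fun j => by rw [e', e]; exact Or.inr ⟨σ j, ⟨j, rfl⟩, rfl⟩)
      have : prism F f g (d + 1) (Finsupp.single σ 1) = prismSimplex F f g (d + 1) σ := by
        simp [prism]
      rw [this]
      refine Finsupp.supported_mono ?_ hm
      intro τ hτ
      classical
      refine ⟨Finset.univ.image τ, (L.isRelLowerSet_faces ht).2 ?_ ?_, by simp⟩
      · intro w hw
        obtain ⟨j, -, rfl⟩ := Finset.mem_image.1 hw
        exact_mod_cast hτ ⟨j, rfl⟩
      · exact Finset.univ_nonempty.image τ
    | zero => simp
    | add x y _ _ hx hy => rw [map_add]; exact add_mem hx hy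
    | smul a x _ hx => rw [map_smul]; exact Submodule.smul_mem _ _ hx
  have hchain : x ∈ chains F K d := by
    cases d with
    | zero => exact hx
    | succ d => exact hx.1
  -- In degree `0` a cycle may have nonzero augmentation; the term still vanishes, since the prism
  -- over the empty tuple is zero.
  have hz : prism F f g d (augBoundary F V d x) = 0 := by
    cases d with
    | zero =>
      have : prism F f g 0 = 0 := by
        ext σ : 2
        simp [prism, prismSimplex]
      rw [this, LinearMap.zero_apply]
    | succ d =>
      have h2 : boundary F V d x = 0 := hx.2
      rw [boundary_eq_augBoundary] at h2
      rw [h2, map_zero]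
  refine ⟨prism F f g (d + 1) x, hprism x hchain, ?_⟩
  have := augBoundary_prism F f g d x
  rw [hz, add_zero] at this
  exact this

end Contiguity

/-! ### Persistent Betti numbers -/

section Betti

theorem finrank_map_mkQ_add_finrank_inf {K M : Type*} [Field K] [AddCommGroup M] [Module K M]
    [FiniteDimensional K M] (Z B : Submodule K M) :
    Module.finrank K (Z.map B.mkQ) + Module.finrank K (Z ⊓ B : Submodule K M) =
      Module.finrank K Z := by
  have := LinearMap.finrank_range_add_finrank_ker (B.mkQ.domRestrict Z)
  rw [LinearMap.range_domRestrict, LinearMap.ker_domRestrict, Submodule.ker_mkQ] at this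
  rw [← this]
  congr 1
  rw [← Submodule.map_comap_subtype]
  exact (LinearEquiv.finrank_eq (Submodule.equivMapOfInjective _
    (Submodule.injective_subtype _) _)).symm

variable (F : Type*) [Field F] (d : ℕ) (V : Type*) [MetricSpace V]

/-- The image of the induced map is `Z_s / (Z_s ∩ B_t)`, realized inside all chains modulo `B_t`.
Betti numbers thereby become dimensions of subspaces of one ambient space. -/
theorem persistentBetti_eq_finrank_map {s t : ℝ} (h : s ≤ t) :
    persistentBetti F d V s t =
      Module.finrank F ((cycles F (ripsComplex V s) d).map
        (boundaries F (ripsComplex V t) d).mkQ) := by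
  rw [persistentBetti, dif_pos h]
  have e : (LinearMap.range (homologyMap F (ripsComplex_mono V h) d)).map
      (Homology F (ripsComplex V t) d).subtype =
      (cycles F (ripsComplex V s) d).map (boundaries F (ripsComplex V t) d).mkQ := by
    ext y
    constructor
    · rintro ⟨_, ⟨⟨_, ⟨x, hx, rfl⟩⟩, rfl⟩, rfl⟩
      exact ⟨x, hx, rfl⟩
    · rintro ⟨x, hx, rfl⟩
      exact ⟨_, ⟨⟨_, ⟨x, hx, rfl⟩⟩, rfl⟩, rfl⟩
  rw [← e]
  exact (LinearEquiv.finrank_eq (Submodule.equivMapOfInjective _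
    (Submodule.injective_subtype _) _))

variable [Finite V]

theorem persistentBetti_add_finrank_inf {s t : ℝ} (h : s ≤ t) :
    persistentBetti F d V s t + Module.finrank F
      (cycles F (ripsComplex V s) d ⊓ boundaries F (ripsComplex V t) d :
        Submodule F (Chain F V d)) =
      Module.finrank F (cycles F (ripsComplex V s) d) := by
  rw [persistentBetti_eq_finrank_map F d V h]
  exact finrank_map_mkQ_add_finrank_inf _ _

theorem persistentBetti_le_card (s t : ℝ) :
    persistentBetti F d V s t ≤ Nat.card V ^ (d + 1) := by
  by_cases h : s ≤ t
  · have h1 := persistentBetti_add_finrank_inf F d V h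
    have h2 := Submodule.finrank_le (cycles F (ripsComplex V s) d)
    have h3 : Module.finrank F (Chain F V d) = Nat.card V ^ (d + 1) := by
      have := Fintype.ofFinite V
      rw [Module.finrank_finsupp_self]
      simp
    omega
  · simp [persistentBetti, h]

/-- Since `β(s, t) = dim Z_s - dim (Z_s ∩ B_t)`, the count equals `dim (Z_b ∩ B_e) - dim ((Z_a ∩
B_e) + (Z_b ∩ B_c))`, the two summands meeting in `Z_a ∩ B_c`. -/
theorem rectangleCount_nonneg {a b c e : ℝ} (hab : a ≤ b) (hbc : b ≤ c) (hce : c ≤ e) :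
    0 ≤ rectangleCount F d V a b c e := by
  have h1 := persistentBetti_add_finrank_inf F d V hbc
  have h2 := persistentBetti_add_finrank_inf F d V (hab.trans hbc)
  have h3 := persistentBetti_add_finrank_inf F d V (hbc.trans hce)
  have h4 := persistentBetti_add_finrank_inf F d V (hab.trans (hbc.trans hce))
  have hZ := cycles_mono F (ripsComplex_mono V hab) d
  have hB := boundaries_mono F (ripsComplex_mono V hce) d
  revert h1 h2 h3 h4 hZ hB
  generalize cycles F (ripsComplex V a) d = Za
  generalize cycles F (ripsComplex V b) d = Zb
  generalize boundaries F (ripsComplex V c) d = Bc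
  generalize boundaries F (ripsComplex V e) d = Be
  intro h1 h2 h3 h4 hZ hB
  have h5 := Submodule.finrank_sup_add_finrank_inf_eq (Za ⊓ Be) (Zb ⊓ Bc)
  have h6 : (Za ⊓ Be) ⊓ (Zb ⊓ Bc) = Za ⊓ Bc := by
    rw [inf_inf_inf_comm, inf_eq_left.2 hZ, inf_eq_right.2 hB]
  have h7 : Module.finrank F ((Za ⊓ Be) ⊔ (Zb ⊓ Bc) : Submodule F (Chain F V d)) ≤
      Module.finrank F (Zb ⊓ Be : Submodule F (Chain F V d)) :=
    Submodule.finrank_mono (sup_le (inf_le_inf_right _ hZ) (inf_le_inf_left _ hB))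
  rw [h6] at h5
  unfold rectangleCount
  omega

/-- Enlarging a rectangle does not decrease its count. -/
theorem rectangleCount_mono {a a' b b' c c' e e' : ℝ} (h1 : a ≤ a') (h2 : a' ≤ b') (h3 : b' ≤ b)
    (h4 : b ≤ c) (h5 : c ≤ c') (h6 : c' ≤ e') (h7 : e' ≤ e) :
    rectangleCount F d V a' b' c' e' ≤ rectangleCount F d V a b c e := by
  -- The outer rectangle splits into the inner one and four others: two strips of full width, and
  -- the two sides of the middle strip.
  have k1 := rectangleCount_nonneg F d V (h1.trans (h2.trans h3)) h4 h5
  have k2 := rectangleCount_nonneg F d V (h1.trans (h2.trans h3)) (h4.trans (h5.trans h6)) h7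
  have k3 := rectangleCount_nonneg F d V h1 (h2.trans (h3.trans (h4.trans h5))) h6
  have k4 := rectangleCount_nonneg F d V h3 (h4.trans h5) h6
  unfold rectangleCount at *
  omega

theorem rectangleCount_le (a b c e : ℝ) :
    rectangleCount F d V a b c e ≤ 2 * Nat.card V ^ (d + 1) := by
  have h1 := persistentBetti_le_card F d V b c
  have h2 := persistentBetti_le_card F d V a e
  unfold rectangleCount
  have h1' : (persistentBetti F d V b c : ℤ) ≤ (Nat.card V ^ (d + 1) : ℕ) := by exact_mod_cast h1
  have h2' : (persistentBetti F d V a e : ℤ) ≤ (Nat.card V ^ (d + 1) : ℕ) := by exact_mod_cast h2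
  push_cast at h1' h2'
  omega

end Betti

/-! ### Critical values -/

section Critical

variable {V : Type*} [MetricSpace V]

theorem exists_dist_eq_diam {s : Finset V} (hs : s.Nonempty) :
    ∃ x ∈ s, ∃ y ∈ s, dist x y = Metric.diam (s : Set V) := by
  obtain ⟨z, hz, hmax⟩ := (s ×ˢ s).exists_max_image (fun z => dist z.1 z.2) (hs.product hs)
  rw [Finset.mem_product] at hz
  refine ⟨z.1, hz.1, z.2, hz.2, le_antisymm
    (Metric.dist_le_diam_of_mem s.finite_toSet.isBounded hz.1 hz.2) ?_⟩
  exact Metric.diam_le_of_forall_dist_le dist_nonneg fun x hx y hy =>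
    hmax (x, y) (Finset.mem_product.2 ⟨hx, hy⟩)

variable {T : Finset ℝ}

/-- Faces have diameter strictly less than the scale, so the complex changes just after a distance,
not at it. Hence only `[s, t)` must avoid `T`, and intervals below are closed on the left and open
on the right. -/
theorem ripsComplex_eq_of_forall_notMem (hT : ∀ x y : V, dist x y ∈ T) {s t : ℝ} (hst : s ≤ t)
    (h : ∀ x ∈ T, s ≤ x → t ≤ x) : ripsComplex V s = ripsComplex V t := by
  refine le_antisymm (ripsComplex_mono V hst) fun σ hσ => ⟨hσ.1, ?_⟩
  obtain ⟨x, -, y, -, e⟩ := exists_dist_eq_diam hσ.1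
  by_contra hlt
  rw [← e, not_lt] at hlt
  have := hσ.2
  rw [← e] at this
  exact this.not_ge (h _ (hT x y) hlt)

variable (F : Type*) [Field F] (d : ℕ)

theorem persistentBetti_congr_left (hT : ∀ x y : V, dist x y ∈ T) {s s' t : ℝ} (hss : s ≤ s')
    (hst : s' ≤ t) (h : ∀ x ∈ T, s ≤ x → s' ≤ x) :
    persistentBetti F d V s t = persistentBetti F d V s' t := by
  rw [persistentBetti_eq_finrank_map F d V hst, persistentBetti_eq_finrank_map F d V
    (hss.trans hst), ripsComplex_eq_of_forall_notMem hT hss h]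

theorem persistentBetti_congr_right (hT : ∀ x y : V, dist x y ∈ T) {s t t' : ℝ} (hst : s ≤ t)
    (htt : t ≤ t') (h : ∀ x ∈ T, t ≤ x → t' ≤ x) :
    persistentBetti F d V s t = persistentBetti F d V s t' := by
  rw [persistentBetti_eq_finrank_map F d V hst, persistentBetti_eq_finrank_map F d V
    (hst.trans htt), ripsComplex_eq_of_forall_notMem hT htt h]

end Critical

/-! ### Comparison of Betti numbers under a retraction -/

section Retraction

variable {V W : Type*} [MetricSpace V] [MetricSpace W]

theorem exists_face_eq_image {f : V → W} {η s : ℝ} (hf : ∀ x y, dist (f x) (f y) ≤ dist x y + η) :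
    ∀ σ ∈ (ripsComplex V s).faces, ∃ τ ∈ (ripsComplex W (s + η)).faces, (τ : Set W) = f '' σ := by
  classical
  intro σ hσ
  refine ⟨σ.image f, ⟨hσ.1.image f, ?_⟩, by simp⟩
  obtain ⟨u, hu, v, hv, e⟩ := exists_dist_eq_diam (hσ.1.image f)
  obtain ⟨x, hx, rfl⟩ := Finset.mem_image.1 hu
  obtain ⟨y, hy, rfl⟩ := Finset.mem_image.1 hv
  rw [← e]
  have := Metric.dist_le_diam_of_mem σ.finite_toSet.isBounded hx hy
  have h1 : Metric.diam (σ : Set V) < s := hσ.2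
  linarith [hf x y]

theorem exists_face_eq_image_union {f : W → W} {ε s : ℝ} (hε : 0 ≤ ε) (hf : ∀ x, dist (f x) x ≤ ε) :
    ∀ σ ∈ (ripsComplex W s).faces,
      ∃ τ ∈ (ripsComplex W (s + 2 * ε)).faces, (τ : Set W) = f '' σ ∪ id '' σ := by
  classical
  intro σ hσ
  refine ⟨σ.image f ∪ σ, ⟨(hσ.1.image f).mono Finset.subset_union_left, ?_⟩, by simp⟩
  have h1 : Metric.diam (σ : Set W) < s := hσ.2
  have key : ∀ u ∈ σ.image f ∪ σ, ∃ x ∈ σ, dist u x ≤ ε := by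
    intro u hu
    rcases Finset.mem_union.1 hu with hu | hu
    · obtain ⟨x, hx, rfl⟩ := Finset.mem_image.1 hu
      exact ⟨x, hx, hf x⟩
    · exact ⟨u, hu, by simpa using hε⟩
  obtain ⟨u, hu, v, hv, e⟩ :=
    exists_dist_eq_diam ((hσ.1.image f).mono (Finset.subset_union_left (s₂ := σ)))
  obtain ⟨x, hx, hux⟩ := key u hu
  obtain ⟨y, hy, hvy⟩ := key v hv
  rw [← e]
  have := Metric.dist_le_diam_of_mem σ.finite_toSet.isBounded hx hy
  have := dist_triangle4 u x y v
  rw [dist_comm v y] at hvy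
  linarith

/-- A `2ε`-interleaving given by a retraction preserves persistent Betti numbers between scales
at which neither filtration changes within `2ε`. -/
theorem persistentBetti_eq_of_retraction (F : Type*) [Field F] (d : ℕ) [Finite V] [Finite W]
    {i : V → W} (hi : Isometry i) {φ : W → V} (hφ : ∀ v, φ (i v) = v) {ε : ℝ} (hε : 0 ≤ ε)
    (hd : ∀ w, dist (i (φ w)) w ≤ ε) {s t : ℝ} (hst : s ≤ t)
    (hWs : ripsComplex W s = ripsComplex W (s + 2 * ε))
    (hVs : ripsComplex V s = ripsComplex V (s + 2 * ε))
    (hVt : ripsComplex V t = ripsComplex V (t + 2 * ε)) :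
    persistentBetti F d V s t = persistentBetti F d W s t := by
  rw [persistentBetti_eq_finrank_map F d V hst, persistentBetti_eq_finrank_map F d W hst]
  have fi : ∀ r, ∀ σ ∈ (ripsComplex V r).faces, ∃ τ ∈ (ripsComplex W r).faces,
      (τ : Set W) = i '' σ := fun r => by
    simpa using exists_face_eq_image (f := i) (η := 0) (s := r)
      fun x y => by rw [hi.dist_eq, add_zero]
  have fφ : ∀ r, ∀ σ ∈ (ripsComplex W r).faces, ∃ τ ∈ (ripsComplex V (r + 2 * ε)).faces,
      (τ : Set V) = φ '' σ := fun r => exists_face_eq_image fun x y => by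
    rw [← hi.dist_eq]
    have := dist_triangle4 (i (φ x)) x y (i (φ y))
    have h2 := hd y
    rw [dist_comm] at h2
    linarith [hd x]
  have hpp : ∀ x : Chain F V d, push F φ (d + 1) (push F i (d + 1) x) = x := by
    intro x
    suffices h : push F φ (d + 1) ∘ₗ push F i (d + 1) = LinearMap.id from LinearMap.congr_fun h x
    ext σ : 2
    simp only [LinearMap.comp_apply, Finsupp.lsingle_apply, push_single, LinearMap.id_apply]
    congr 1
    funext j
    exact hφ _
  have hpp' : ∀ x : Chain F W d,
      push F i (d + 1) (push F φ (d + 1) x) = push F (i ∘ φ) (d + 1) x := by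
    intro x
    suffices h : push F i (d + 1) ∘ₗ push F φ (d + 1) = push F (i ∘ φ) (d + 1) from
      LinearMap.congr_fun h x
    ext σ : 2
    simp only [LinearMap.comp_apply, Finsupp.lsingle_apply, push_single]
    rfl
  have hid : ∀ x : Chain F W d, push F id (d + 1) x = x := by
    intro x
    suffices h : push F (id : W → W) (d + 1) = LinearMap.id from LinearMap.congr_fun h x
    ext σ : 2
    simp
  have bi : boundaries F (ripsComplex V t) d ≤
      (boundaries F (ripsComplex W t) d).comap (push F i (d + 1)) :=
    fun x hx => push_mem_boundaries (fi t) hx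
  have bφ : boundaries F (ripsComplex W t) d ≤
      (boundaries F (ripsComplex V t) d).comap (push F φ (d + 1)) := by
    -- `φ` may add `2ε` to distances; the filtration of `V` does not change over that range after
    -- `t`.
    rw [hVt]
    exact fun x hx => push_mem_boundaries (fφ t) hx
  apply le_antisymm
  -- Each class from `V` is the image under `φ` of a class from `W`, because `φ ∘ i` is the
  -- identity.
  · have e : (cycles F (ripsComplex V s) d).map (boundaries F (ripsComplex V t) d).mkQ ≤
        ((cycles F (ripsComplex W s) d).map (boundaries F (ripsComplex W t) d).mkQ).map
          (Submodule.mapQ _ _ (push F φ (d + 1)) bφ) := by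
      rintro _ ⟨x, hx, rfl⟩
      refine ⟨_, ⟨push F i (d + 1) x, push_mem_cycles (fi s) hx, rfl⟩, ?_⟩
      rw [Submodule.mkQ_apply, Submodule.mapQ_apply, hpp, Submodule.mkQ_apply]
    exact (Submodule.finrank_mono e).trans (Submodule.finrank_map_le _ _)
  -- Each class from `W` is hit: the contiguous maps `i ∘ φ` and `id` agree on homology at scale `s
  -- + 2ε`, where the complex of `W` is still that of scale `s`.
  · have e : (cycles F (ripsComplex W s) d).map (boundaries F (ripsComplex W t) d).mkQ ≤
        ((cycles F (ripsComplex V s) d).map (boundaries F (ripsComplex V t) d).mkQ).map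
          (Submodule.mapQ _ _ (push F i (d + 1)) bi) := by
      rintro _ ⟨x, hx, rfl⟩
      refine ⟨_, ⟨push F φ (d + 1) x, ?_, rfl⟩, ?_⟩
      · rw [hVs]
        exact push_mem_cycles (fφ s) hx
      · rw [Submodule.mkQ_apply, Submodule.mapQ_apply, hpp', Submodule.mkQ_apply, eq_comm,
          Submodule.Quotient.eq]
        have h1 := push_sub_push_mem_boundaries
          (exists_face_eq_image_union (s := s) hε (f := i ∘ φ) hd) hx
        rw [← hWs, hid] at h1
        exact boundaries_mono F (ripsComplex_mono W hst) d h1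
    exact (Submodule.finrank_mono e).trans (Submodule.finrank_map_le _ _)

end Retraction

/-! ### Multiplicities -/

section Multiplicity

theorem exists_separation (T : Finset ℝ) :
    ∃ δ : ℝ, 0 < δ ∧ ∀ u ∈ T, ∀ v ∈ T, u < v → u + 2 * δ < v := by
  have h : ∀ᶠ δ : ℝ in nhdsWithin 0 (Set.Ioi 0),
      ∀ u ∈ T, ∀ v ∈ T, u < v → u + 2 * δ < v := by
    refine (Filter.eventually_all_finset T).2 fun u _ =>
      (Filter.eventually_all_finset T).2 fun v _ => ?_
    by_cases huv : u < v
    · have : Filter.Tendsto (fun δ : ℝ => u + 2 * δ) (nhds 0) (nhds (u + 2 * 0)) :=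
        Continuous.tendsto (by fun_prop) 0
      rw [mul_zero, add_zero] at this
      filter_upwards [nhdsWithin_le_nhds (this.eventually_lt_const huv)] with δ hδ _ using hδ
    · exact Filter.Eventually.of_forall fun δ h => absurd h huv
  obtain ⟨δ, h1, h2⟩ := (h.and self_mem_nhdsWithin).exists
  exact ⟨δ, h2, h1⟩

/-- A function that is constant between the points of `T` is the sum of its jumps. -/
theorem sum_jumps {T : Finset ℝ} {δ : ℝ} (hδ : 0 < δ) (hsep : ∀ u ∈ T, ∀ v ∈ T, u < v → u + δ < v)
    {g : ℝ → ℤ} {a : ℝ} (ha : a ∈ T) {n : ℕ} :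
    ∀ {b : ℝ}, (T.filter fun x => a ≤ x ∧ x < b).card = n → b ∈ T → a ≤ b →
    (∀ s t, a ≤ s → s ≤ t → t ≤ b → (∀ x ∈ T, s ≤ x → t ≤ x) → g s = g t) →
    ∑ x ∈ T with a ≤ x ∧ x < b, (g (x + δ) - g x) = g b - g a := by
  induction n with
  | zero =>
    intro b hn hb hab hg
    have he := Finset.card_eq_zero.1 hn
    have : a = b := by
      by_contra hne
      have : a ∈ T.filter fun x => a ≤ x ∧ x < b := by simp [ha, lt_of_le_of_ne hab hne]
      rw [he] at this
      simp at this
    rw [he, this]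
    simp
  | succ n ih =>
    intro b hn hb hab hg
    obtain ⟨x, hx, hmax⟩ := (T.filter fun x => a ≤ x ∧ x < b).exists_max_image id
      (Finset.card_pos.1 (by omega))
    simp only [Finset.mem_filter, id] at hx hmax
    obtain ⟨hxT, hax, hxb⟩ := hx
    have hins : (T.filter fun y => a ≤ y ∧ y < b) =
        insert x (T.filter fun y => a ≤ y ∧ y < x) := by
      ext y
      simp only [Finset.mem_filter, Finset.mem_insert]
      constructor
      · rintro ⟨hy, hay, hyb⟩
        rcases (hmax y ⟨hy, hay, hyb⟩).lt_or_eq with h | h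
        · exact Or.inr ⟨hy, hay, h⟩
        · exact Or.inl h
      · rintro (rfl | ⟨hy, hay, hyx⟩)
        · exact ⟨hxT, hax, hxb⟩
        · exact ⟨hy, hay, hyx.trans hxb⟩
    have hnot : x ∉ T.filter fun y => a ≤ y ∧ y < x := by simp
    rw [hins, Finset.card_insert_of_notMem hnot] at hn
    rw [hins, Finset.sum_insert hnot, ih (by omega) hxT hax
      fun s t h1 h2 h3 h4 => hg s t h1 h2 (h3.trans hxb.le) h4]
    -- `x` is the last point of `T` before `b`, so `g` is constant from `x + δ` to `b`.
    have := hg (x + δ) b (by linarith) (hsep x hxT b hb hxb).le le_rfl fun y hy hxy => by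
      by_contra hyb
      rw [not_le] at hyb
      have := hmax y ⟨hy, by linarith, hyb⟩
      linarith
    rw [this]
    ring

variable (F : Type*) [Field F] (d : ℕ) {V : Type*} [MetricSpace V] [Finite V] {T : Finset ℝ}

/-- Shrinking a rectangle does not increase its count, and the count is constant once all sides are
within `δ` of the point; the infimum is that constant. Left-continuity in the scale allows the lower
sides to be `x` and `y` themselves. -/
theorem multiplicity_eq (hT : ∀ x y : V, dist x y ∈ T) {δ : ℝ} (hδ : 0 < δ)
    (hsep : ∀ u ∈ T, ∀ v ∈ T, u < v → u + 2 * δ < v) {x y : ℝ} (hx : x ∈ T) (hy : y ∈ T)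
    (hxy : x < y) :
    (multiplicity F d V (x, y) : ℤ) = rectangleCount F d V x (x + δ) y (y + δ) := by
  have hloc : ∀ η, 0 < η → η ≤ δ → rectangleCount F d V (x - η) (x + η) (y - η) (y + η) =
      rectangleCount F d V x (x + δ) y (y + δ) := by
    intro η h0 h1
    have hs := hsep x hx y hy hxy
    have lower : ∀ z ∈ T, ∀ u ∈ T, z - η ≤ u → z ≤ u := fun z hz u hu h => by
      by_contra hlt
      have := hsep u hu z hz (not_le.1 hlt)
      linarith
    have upper : ∀ z ∈ T, ∀ u ∈ T, z + η ≤ u → z + δ ≤ u := fun z hz u hu h => by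
      have := hsep z hz u hu (by linarith)
      linarith
    have l : ∀ t, x + δ ≤ t → persistentBetti F d V (x - η) t = persistentBetti F d V x t :=
      fun t ht => persistentBetti_congr_left F d hT (by linarith) (by linarith) (lower x hx)
    have u : ∀ t, x + δ ≤ t → persistentBetti F d V (x + η) t = persistentBetti F d V (x + δ) t :=
      fun t ht => persistentBetti_congr_left F d hT (by linarith) (by linarith) (upper x hx)
    have l' : ∀ s, s ≤ x + δ → persistentBetti F d V s (y - η) = persistentBetti F d V s y :=
      fun s hs => persistentBetti_congr_right F d hT (by linarith) (by linarith) (lower y hy)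
    have u' : ∀ s, s ≤ x + δ → persistentBetti F d V s (y + η) = persistentBetti F d V s (y + δ) :=
      fun s hs => persistentBetti_congr_right F d hT (by linarith) (by linarith) (upper y hy)
    unfold rectangleCount
    rw [l _ (by linarith), u _ (by linarith), l _ (by linarith), u _ (by linarith),
      l' _ (by linarith), l' _ (by linarith), u' _ (by linarith), u' _ (by linarith)]
  have hs := hsep x hx y hy hxy
  have hnn : 0 ≤ rectangleCount F d V x (x + δ) y (y + δ) :=
    rectangleCount_nonneg F d V (by linarith) (by linarith) (by linarith)
  obtain ⟨k, hk⟩ := Int.eq_ofNat_of_zero_le hnn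
  rw [hk]
  congr 1
  apply le_antisymm
  · exact Nat.sInf_le ⟨x - δ, x + δ, y - δ, y + δ, by simpa, by simpa, by linarith, by simpa,
      by simpa, by rw [hloc δ hδ le_rfl, hk]⟩
  · refine le_csInf ⟨k, x - δ, x + δ, y - δ, y + δ, by simpa, by simpa, by linarith, by simpa,
      by simpa, by rw [hloc δ hδ le_rfl, hk]⟩ ?_
    rintro m ⟨a, b, c, e, h1, h2, h3, h4, h5, hm⟩
    simp only at h1 h2 h4 h5
    obtain ⟨η, h0, hη⟩ : ∃ η, 0 < η ∧ η ≤ δ ∧ a ≤ x - η ∧ x + η ≤ b ∧ c ≤ y - η ∧ y + η ≤ e := by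
      refine ⟨min δ (min (min (x - a) (b - x)) (min (y - c) (e - y))), ?_, ?_⟩
      · simp only [lt_min_iff, sub_pos]
        exact ⟨hδ, ⟨h1, h2⟩, h4, h5⟩
      · have k1 := min_le_left δ (min (min (x - a) (b - x)) (min (y - c) (e - y)))
        have k2 := min_le_right δ (min (min (x - a) (b - x)) (min (y - c) (e - y)))
        simp only [le_min_iff] at k2
        exact ⟨k1, by linarith, by linarith, by linarith, by linarith⟩
    have := rectangleCount_mono F d V hη.2.1 (by linarith) hη.2.2.1 h3.le hη.2.2.2.1 (by linarith)
      hη.2.2.2.2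
    rw [hloc η h0 hη.1, hk, ← hm] at this
    exact_mod_cast this

/-- With `x` and `y` adjoined to `T`, `multiplicity_eq` applies, and Betti numbers have no jump at a
coordinate outside `T`. -/
theorem multiplicity_eq_zero (hT : ∀ x y : V, dist x y ∈ T) {x y : ℝ} (hxy : x < y)
    (h : x ∉ T ∨ y ∉ T) : multiplicity F d V (x, y) = 0 := by
  classical
  obtain ⟨δ, hδ, hsep⟩ := exists_separation (insert x (insert y T))
  have hx : x ∈ insert x (insert y T) := by simp
  have hy : y ∈ insert x (insert y T) := by simp
  have hs := hsep x hx y hy hxy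
  have key := multiplicity_eq F d (V := V) (T := insert x (insert y T))
    (fun u v => by simp [hT u v]) hδ hsep hx hy hxy
  have gap : ∀ z ∈ insert x (insert y T), z ∉ T → ∀ u ∈ T, z ≤ u → z + δ ≤ u := by
    intro z hz hzT u hu hzu
    have : z ≠ u := fun e => hzT (e ▸ hu)
    have := hsep z hz u (by simp [hu]) (lt_of_le_of_ne hzu this)
    linarith
  have h0 : rectangleCount F d V x (x + δ) y (y + δ) = 0 := by
    unfold rectangleCount
    rcases h with h | h
    · rw [persistentBetti_congr_left F d hT (s := x) (s' := x + δ) (by linarith) (by linarith)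
        (gap x hx h), persistentBetti_congr_left F d hT (s := x) (s' := x + δ) (by linarith)
        (by linarith) (gap x hx h)]
      ring
    · rw [persistentBetti_congr_right F d hT (t := y) (t' := y + δ) (by linarith) (by linarith)
        (gap y hy h), persistentBetti_congr_right F d hT (t := y) (t' := y + δ) (by linarith)
        (by linarith) (gap y hy h)]
      ring
  rw [h0] at key
  exact_mod_cast key

theorem multiplicity_le {x y : ℝ} (hxy : x < y) :
    multiplicity F d V (x, y) ≤ 2 * Nat.card V ^ (d + 1) := by
  classical
  have := Fintype.ofFinite V
  set T : Finset ℝ := insert x (insert y (Finset.univ.image fun z : V × V => dist z.1 z.2)) with hT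
  obtain ⟨δ, hδ, hsep⟩ := exists_separation T
  have key := multiplicity_eq F d (V := V) (T := T) (fun u v => by
    rw [hT]
    exact Finset.mem_insert_of_mem (Finset.mem_insert_of_mem
      (Finset.mem_image.2 ⟨(u, v), Finset.mem_univ _, rfl⟩))) hδ hsep (by simp [hT])
    (by simp [hT]) hxy
  have h2 := rectangleCount_le F d V x (x + δ) y (y + δ)
  rw [← key] at h2
  exact_mod_cast h2

/-- The count is a double difference of a function that is a step function of each scale. The jumps
telescope, first in the death and then in the birth coordinate. -/
theorem sum_multiplicity_eq_rectangleCount (hT : ∀ x y : V, dist x y ∈ T) {a b c e : ℝ}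
    (ha : a ∈ T) (hb : b ∈ T) (hc : c ∈ T) (he : e ∈ T) (hab : a ≤ b) (hbc : b ≤ c) (hce : c ≤ e) :
    ∑ x ∈ T with a ≤ x ∧ x < b, ∑ y ∈ T with c ≤ y ∧ y < e, (multiplicity F d V (x, y) : ℤ) =
      rectangleCount F d V a b c e := by
  obtain ⟨δ, hδ, hsep⟩ := exists_separation T
  have hsep' : ∀ u ∈ T, ∀ v ∈ T, u < v → u + δ < v := fun u hu v hv h => by
    have := hsep u hu v hv h
    linarith
  have h1 : ∀ x ∈ T, a ≤ x → x < b →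
      ∑ y ∈ T with c ≤ y ∧ y < e, (multiplicity F d V (x, y) : ℤ) =
        rectangleCount F d V x (x + δ) c e := by
    intro x hx hax hxb
    have hxδ := hsep' x hx b hb hxb
    have := sum_jumps hδ hsep' (g := fun t => (persistentBetti F d V x t : ℤ) -
      persistentBetti F d V (x + δ) t) hc rfl he hce (fun s t h1 h2 h3 h4 => by
        rw [persistentBetti_congr_right F d hT (by linarith) h2 h4,
          persistentBetti_congr_right F d hT (by linarith) h2 h4])
    refine Eq.trans ?_ (this.trans ?_)
    · refine Finset.sum_congr rfl fun y hy => ?_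
      simp only [Finset.mem_filter] at hy
      rw [multiplicity_eq F d hT hδ hsep hx hy.1 (by linarith)]
      unfold rectangleCount
      ring
    · unfold rectangleCount
      ring
  have := sum_jumps hδ hsep' (g := fun s => (persistentBetti F d V s c : ℤ) -
      persistentBetti F d V s e) ha rfl hb hab (fun s t h1 h2 h3 h4 => by
        rw [persistentBetti_congr_left F d hT h2 (by linarith) h4,
          persistentBetti_congr_left F d hT h2 (by linarith) h4])
  refine Eq.trans ?_ (this.trans ?_)
  · refine Finset.sum_congr rfl fun x hx => ?_
    simp only [Finset.mem_filter] at hx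
    rw [h1 x hx.1 hx.2.1 hx.2.2]
    unfold rectangleCount
    ring
  · unfold rectangleCount
    ring

end Multiplicity

/-! ### The diagram as a finite sum -/

section Diagram

variable (F : Type*) [Field F] (d : ℕ) {E : Type*} [MetricSpace E] {S : Set E} [Finite S]
  {T : Finset ℝ}

theorem diagram_eq_sum (hT : ∀ x y : S, dist x y ∈ T) :
    diagram F d S = ∑ z ∈ (T ×ˢ T).filter (fun z => z.1 < z.2),
      (multiplicity F d S z : ℝ≥0∞) • Measure.dirac z := by
  classical
  ext A hA
  rw [diagram, Measure.sum_apply _ hA]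
  rw [tsum_eq_sum (s := (T ×ˢ T).subtype (· ∈ halfPlane))]
  · simp only [Measure.coe_finsetSum, Finset.sum_apply]
    rw [Finset.sum_subtype_eq_sum_filter (s := T ×ˢ T) (p := (· ∈ halfPlane))
      (f := fun z => ((multiplicity F d S z : ℝ≥0∞) • Measure.dirac z) A)]
    rfl
  · rintro ⟨⟨x, y⟩, hxy⟩ hz
    have hor : x ∉ T ∨ y ∉ T := by
      rw [Finset.mem_subtype, Finset.mem_product] at hz
      simpa [imp_iff_not_or] using hz
    simp [multiplicity_eq_zero F d hT hxy hor]

/-- A Betti number `β(s, t)` sees births `< s` and deaths `≥ t`, which is why the boxes are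
half-open. -/
theorem diagram_Ico_prod_Ico (hT : ∀ x y : S, dist x y ∈ T) {a b c e : ℝ}
    (hab : a ≤ b) (hbc : b ≤ c) (hce : c ≤ e) :
    diagram F d S (Set.Ico a b ×ˢ Set.Ico c e) = ((rectangleCount F d S a b c e).toNat : ℝ≥0∞) := by
  classical
  -- The corners are adjoined so that the telescoping sums can start and end at them.
  set T' : Finset ℝ := T ∪ {a, b, c, e} with hT'
  have hT1 : ∀ x y : S, dist x y ∈ T' := fun x y => Finset.mem_union_left _ (hT x y)
  rw [← sum_multiplicity_eq_rectangleCount F d hT1 (a := a) (b := b) (c := c) (e := e)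
    (by simp [hT']) (by simp [hT']) (by simp [hT']) (by simp [hT']) hab hbc hce,
    diagram_eq_sum F d hT1]
  simp only [Measure.coe_finsetSum, Finset.sum_apply, Measure.smul_apply, smul_eq_mul]
  have : (∑ x ∈ T' with a ≤ x ∧ x < b, ∑ y ∈ T' with c ≤ y ∧ y < e,
      (multiplicity F d S (x, y) : ℤ)).toNat =
      ∑ x ∈ T' with a ≤ x ∧ x < b, ∑ y ∈ T' with c ≤ y ∧ y < e, multiplicity F d S (x, y) := by
    exact_mod_cast Int.toNat_natCast _
  rw [this, ← Finset.sum_product']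
  push_cast
  simp only [Measure.dirac_apply' _ (measurableSet_Ico.prod measurableSet_Ico), Set.indicator_apply,
    Pi.one_apply, mul_ite, mul_one, mul_zero]
  rw [← Finset.sum_filter]
  refine Finset.sum_congr ?_ fun z _ => rfl
  ext ⟨x, y⟩
  simp only [Finset.mem_filter, Finset.mem_product, Set.mem_prod, Set.mem_Ico]
  constructor
  · rintro ⟨⟨⟨h1, h2⟩, h3⟩, h4, h5⟩
    exact ⟨⟨h1, h4⟩, h2, h5⟩
  · rintro ⟨⟨h1, h4⟩, h2, h5⟩
    exact ⟨⟨⟨h1, h2⟩, by linarith [h4.2, h5.1]⟩, h4, h5⟩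

theorem diagram_univ_le (hT : ∀ x y : S, dist x y ∈ T) :
    diagram F d S Set.univ ≤ ((T.card ^ 2 * (2 * Nat.card S ^ (d + 1)) : ℕ) : ℝ≥0∞) := by
  rw [diagram_eq_sum F d hT]
  simp only [Measure.coe_finsetSum, Finset.sum_apply, Measure.smul_apply, smul_eq_mul,
    measure_univ, mul_one]
  rw [← Nat.cast_sum]
  refine Nat.cast_le.2 ((Finset.sum_le_card_nsmul _ _ (2 * Nat.card S ^ (d + 1)) ?_).trans ?_)
  · rintro ⟨x, y⟩ hz
    exact multiplicity_le F d (Finset.mem_filter.1 hz).2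
  · rw [smul_eq_mul]
    refine Nat.mul_le_mul_right _ ((Finset.card_filter_le _ _).trans ?_)
    rw [Finset.card_product, sq]

theorem diagram_compl (hT : ∀ x y : S, dist x y ∈ T) :
    diagram F d S {z | z.1 ∈ T ∧ z.2 ∈ T ∧ z.1 < z.2}ᶜ = 0 := by
  classical
  have hfin : {z : ℝ × ℝ | z.1 ∈ T ∧ z.2 ∈ T ∧ z.1 < z.2}.Finite :=
    (T ×ˢ T).finite_toSet.subset fun z hz => by simpa using ⟨hz.1, hz.2.1⟩
  rw [diagram_eq_sum F d hT]
  simp only [Measure.coe_finsetSum, Finset.sum_apply, Measure.smul_apply, smul_eq_mul]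
  refine Finset.sum_eq_zero fun z hz => ?_
  rw [Measure.dirac_apply' _ hfin.measurableSet.compl, Set.indicator_of_notMem, mul_zero]
  simp only [Finset.mem_filter, Finset.mem_product] at hz
  simpa using ⟨hz.1.1, hz.1.2, hz.2⟩

end Diagram

/-! ### Construction of partial transport plans -/

section Plans

theorem OT_rpow_le {p : ℝ} (hp : 1 ≤ p) {μ ν : Measure (ℝ × ℝ)} {γ : Measure ((ℝ × ℝ) × (ℝ × ℝ))}
    (h : IsPartialPlan μ ν γ) :
    OT p μ ν ^ p ≤ ∫⁻ w, ENNReal.ofReal (cost p w.1 w.2) ∂γ := by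
  have h1 : OT p μ ν ≤ (∫⁻ w, ENNReal.ofReal (cost p w.1 w.2) ∂γ) ^ (1 / p) := iInf₂_le γ h
  calc OT p μ ν ^ p ≤ ((∫⁻ w, ENNReal.ofReal (cost p w.1 w.2) ∂γ) ^ (1 / p)) ^ p :=
        ENNReal.rpow_le_rpow h1 (by linarith)
    _ = _ := by rw [← ENNReal.rpow_mul, one_div_mul_cancel (by linarith), ENNReal.rpow_one]

/-- Averages of plans are plans, so that `OT_p ^ p` is convex. -/
theorem IsPartialPlan.mean {B : ℕ} (hB : 1 ≤ B) {μ : Fin B → Measure (ℝ × ℝ)} {ν : Measure (ℝ × ℝ)}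
    {γ : Fin B → Measure ((ℝ × ℝ) × (ℝ × ℝ))} (h : ∀ i, IsPartialPlan (μ i) ν (γ i)) :
    IsPartialPlan ((B : ℝ≥0∞)⁻¹ • ∑ i, μ i) ν ((B : ℝ≥0∞)⁻¹ • ∑ i, γ i) where
  locallyFinite := by
    have hB0 : (B : ℝ≥0∞) ≠ 0 := by exact_mod_cast (by omega : B ≠ 0)
    refine ⟨fun x => ?_⟩
    have := fun i => (h i).locallyFinite
    have hU := fun i => (γ i).finiteAt_nhds x
    choose U hU1 hU2 using hU
    refine ⟨⋂ i, U i, Filter.iInter_mem.2 hU1, ?_⟩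
    rw [Measure.smul_apply, smul_eq_mul, Measure.coe_finsetSum, Finset.sum_apply]
    refine ENNReal.mul_lt_top (ENNReal.inv_lt_top.2 (pos_iff_ne_zero.2 hB0)) ?_
    exact ENNReal.sum_lt_top.2 fun i _ =>
      (measure_mono (Set.iInter_subset U i)).trans_lt (hU2 i)
  carried := by simp [fun i => (h i).carried]
  left P hP hm := by simp [fun i => (h i).left P hP hm]
  right Q hQ hm := by
    simp only [Measure.smul_apply, Measure.coe_finsetSum, Finset.sum_apply,
      fun i => (h i).right Q hQ hm, Finset.sum_const, Finset.card_univ, Fintype.card_fin,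
      smul_eq_mul, nsmul_eq_mul]
    rw [← mul_assoc, ENNReal.inv_mul_cancel (by exact_mod_cast (by omega : B ≠ 0))
      (ENNReal.natCast_ne_top B), one_mul]

variable {T : Finset ℝ} {κ : ℝ → ℕ}

/-- The points above the diagonal with coordinates in `T`. -/
def gridPoints (T : Finset ℝ) : Set (ℝ × ℝ) := {z | z.1 ∈ T ∧ z.2 ∈ T ∧ z.1 < z.2}

/-- The grid points whose coordinates have labels `q`. -/
def gridBox (T : Finset ℝ) (κ : ℝ → ℕ) (q : ℕ × ℕ) : Set (ℝ × ℝ) :=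
  {z | z ∈ gridPoints T ∧ κ z.1 = q.1 ∧ κ z.2 = q.2}

/-- The grid points both of whose coordinates have the same label. -/
def gridDiagonal (T : Finset ℝ) (κ : ℝ → ℕ) : Set (ℝ × ℝ) :=
  {z | z ∈ gridPoints T ∧ κ z.1 = κ z.2}

theorem finite_gridPoints (T : Finset ℝ) : (gridPoints T).Finite :=
  (T ×ˢ T).finite_toSet.subset fun z hz => by simpa using ⟨hz.1, hz.2.1⟩

theorem measurableSet_gridBox (q : ℕ × ℕ) : MeasurableSet (gridBox T κ q) :=
  ((finite_gridPoints T).subset fun _ h => h.1).measurableSet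

theorem measurableSet_gridDiagonal : MeasurableSet (gridDiagonal T κ) :=
  ((finite_gridPoints T).subset fun _ h => h.1).measurableSet

/-- A monotone label cannot decrease from birth to death, so each grid point has strictly increasing
labels or equal ones. -/
theorem sum_measure_gridBox {μ : Measure (ℝ × ℝ)} (hμ : μ (gridPoints T)ᶜ = 0) (hκ : Monotone κ)
    {K : ℕ} (hK : ∀ x, κ x < K) {P : Set (ℝ × ℝ)} (hP : MeasurableSet P) :
    ∑ q ∈ (Finset.range K ×ˢ Finset.range K).filter (fun q => q.1 < q.2), μ (P ∩ gridBox T κ q) +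
      μ (P ∩ gridDiagonal T κ) = μ P := by
  rw [← measure_biUnion_finset, ← measure_union, ← measure_inter_conull (s := P) hμ]
  · congr 1
    ext z
    simp only [Set.mem_union, Set.mem_iUnion, Set.mem_inter_iff, Finset.mem_filter,
      Finset.mem_product, Finset.mem_range, gridBox, gridDiagonal, Set.mem_ofPred_eq, exists_prop]
    constructor
    · rintro (⟨q, -, h1, h2, -⟩ | ⟨h1, h2, -⟩) <;> exact ⟨h1, h2⟩
    · rintro ⟨h1, h2⟩
      rcases (hκ h2.2.2.le).lt_or_eq with h | h
      · exact Or.inl ⟨(κ z.1, κ z.2), ⟨⟨hK _, hK _⟩, h⟩, h1, h2, rfl, rfl⟩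
      · exact Or.inr ⟨h1, h2, h⟩
  · refine Set.disjoint_left.2 fun z hz hz' => ?_
    simp only [Set.mem_iUnion] at hz
    obtain ⟨q, hq, h1, h2, h3, h4⟩ := hz
    have := (Finset.mem_filter.1 hq).2
    rw [← h3, ← h4, hz'.2.2] at this
    exact lt_irrefl _ this
  · exact hP.inter measurableSet_gridDiagonal
  · intro q _ q' _ hqq
    refine Set.disjoint_left.2 fun z hz hz' => hqq ?_
    exact Prod.ext (hz.2.2.1.symm.trans hz'.2.2.1) (hz.2.2.2.symm.trans hz'.2.2.2)
  · exact fun q _ => hP.inter (measurableSet_gridBox q)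

/-- Measures that give the same mass to each off-diagonal box of a partition into boxes can be
coupled by moving mass only within boxes, or from the diagonal boxes to the diagonal. -/
theorem exists_isPartialPlan {μ ν : Measure (ℝ × ℝ)} [IsFiniteMeasure μ] [IsFiniteMeasure ν]
    (hμ : μ (gridPoints T)ᶜ = 0) (hν : ν (gridPoints T)ᶜ = 0) (hκ : Monotone κ)
    {K : ℕ} (hK : ∀ x, κ x < K) {L p : ℝ} (hp : 1 ≤ p)
    (hL : ∀ x ∈ T, ∀ y ∈ T, κ x = κ y → |x - y| ≤ L)
    (hbox : ∀ q : ℕ × ℕ, q.1 < q.2 → μ (gridBox T κ q) = ν (gridBox T κ q)) :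
    ∃ γ, IsPartialPlan μ ν γ ∧ ∫⁻ w, ENNReal.ofReal (cost p w.1 w.2) ∂γ ≤
      ENNReal.ofReal (2 * L ^ p) * (μ Set.univ + ν Set.univ) := by
  set I := (Finset.range K ×ˢ Finset.range K).filter (fun q => q.1 < q.2) with hI
  set Q := gridBox T κ with hQ
  set D := gridDiagonal T κ with hD
  have mQ : ∀ q, MeasurableSet (Q q) := measurableSet_gridBox
  have mD : MeasurableSet D := measurableSet_gridDiagonal
  have mr : Measurable fun z : ℝ × ℝ => (z, ((z.1, z.1) : ℝ × ℝ)) := by fun_prop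
  have ml : Measurable fun z : ℝ × ℝ => (((z.1, z.1) : ℝ × ℝ), z) := by fun_prop
  have mC : MeasurableSet closedHalfPlane := measurableSet_le measurable_fst measurable_snd
  have hQC : ∀ q, Q q ⊆ closedHalfPlane := fun q z hz => hz.1.2.2.le
  have hDC : D ⊆ closedHalfPlane := fun z hz => hz.1.2.2.le
  -- In an off-diagonal box the plan is the normalized product measure. The remaining mass goes to,
  -- or comes from, the diagonal point `(z.1, z.1)`; the marginal conditions do not constrain mass
  -- there.
  set γ : Measure ((ℝ × ℝ) × (ℝ × ℝ)) :=
    (∑ q ∈ I, (ν (Q q))⁻¹ • (μ.prod ν).restrict (Q q ×ˢ Q q)) +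
      (μ.restrict D).map (fun z => (z, (z.1, z.1))) +
      (ν.restrict D).map (fun z => ((z.1, z.1), z)) with hγ
  have cancel : ∀ q ∈ I, ∀ x, (x ≤ ν (Q q)) → (ν (Q q))⁻¹ * (x * ν (Q q)) = x := by
    intro q hq x hx
    -- For a null box the factor `∞` multiplies `0`, which is `0` in `ℝ≥0∞`.
    by_cases h0 : ν (Q q) = 0
    · rw [h0] at hx ⊢
      simp [nonpos_iff_eq_zero.1 hx]
    · rw [mul_comm x, ← mul_assoc, ENNReal.inv_mul_cancel h0 (measure_ne_top _ _), one_mul]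
  have hμν : ∀ q ∈ I, μ (Q q) = ν (Q q) := fun q hq => hbox q (Finset.mem_filter.1 hq).2
  have hγapp : ∀ A, MeasurableSet A → γ A = (∑ q ∈ I, (ν (Q q))⁻¹ * (μ.prod ν) (A ∩ Q q ×ˢ Q q)) +
      μ ((fun z : ℝ × ℝ => (z, ((z.1, z.1) : ℝ × ℝ))) ⁻¹' A ∩ D) +
      ν ((fun z : ℝ × ℝ => (((z.1, z.1) : ℝ × ℝ), z)) ⁻¹' A ∩ D) := by
    intro A hA
    rw [hγ, Measure.add_apply, Measure.add_apply, Measure.map_apply mr hA, Measure.map_apply ml hA,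
      Measure.restrict_apply (mr hA), Measure.restrict_apply (ml hA), Measure.coe_finsetSum,
      Finset.sum_apply]
    simp only [Measure.smul_apply, smul_eq_mul, Measure.restrict_apply hA]
  refine ⟨γ, ⟨?_, ?_, ?_, ?_⟩, ?_⟩
  · have : IsFiniteMeasure γ := by
      refine ⟨?_⟩
      rw [hγapp _ MeasurableSet.univ]
      refine ENNReal.add_lt_top.2 ⟨ENNReal.add_lt_top.2 ⟨ENNReal.sum_lt_top.2 fun q hq => ?_,
        measure_lt_top _ _⟩, measure_lt_top _ _⟩
      rw [Set.univ_inter, Measure.prod_prod, cancel q hq _ (hμν q hq).le]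
      exact measure_lt_top _ _
    infer_instance
  · rw [hγapp _ (mC.prod mC).compl]
    have e1 : ∀ q, (closedHalfPlane ×ˢ closedHalfPlane)ᶜ ∩ Q q ×ˢ Q q = ∅ := fun q =>
      Set.disjoint_iff_inter_eq_empty.1 (Set.disjoint_compl_left_iff_subset.2
        (Set.prod_mono (hQC q) (hQC q)))
    have e2 : (fun z : ℝ × ℝ => (z, ((z.1, z.1) : ℝ × ℝ))) ⁻¹'
        (closedHalfPlane ×ˢ closedHalfPlane)ᶜ ∩ D = ∅ :=
      Set.eq_empty_of_forall_notMem fun z hz => hz.1 ⟨hDC hz.2, le_refl z.1⟩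
    have e3 : (fun z : ℝ × ℝ => (((z.1, z.1) : ℝ × ℝ), z)) ⁻¹'
        (closedHalfPlane ×ˢ closedHalfPlane)ᶜ ∩ D = ∅ :=
      Set.eq_empty_of_forall_notMem fun z hz => hz.1 ⟨le_refl z.1, hDC hz.2⟩
    simp only [e1, e2, e3, measure_empty, mul_zero, Finset.sum_const_zero, add_zero]
  · intro P hP mP
    rw [hγapp _ (mP.prod mC)]
    have e2 : (fun z : ℝ × ℝ => (z, ((z.1, z.1) : ℝ × ℝ))) ⁻¹' (P ×ˢ closedHalfPlane) ∩ D =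
        P ∩ D := by
      ext z
      simp [closedHalfPlane]
    have e3 : (fun z : ℝ × ℝ => (((z.1, z.1) : ℝ × ℝ), z)) ⁻¹' (P ×ˢ closedHalfPlane) ∩ D = ∅ := by
      ext z
      simp only [Set.mem_inter_iff, Set.mem_preimage, Set.mem_prod, Set.mem_empty_iff_false,
        iff_false, not_and]
      exact fun h => absurd (hP h.1) (lt_irrefl z.1)
    rw [e2, e3, measure_empty, add_zero, ← sum_measure_gridBox hμ hκ hK mP]
    congr 1
    refine Finset.sum_congr rfl fun q hq => ?_
    rw [Set.prod_inter_prod, Set.inter_eq_right.2 (hQC q), Measure.prod_prod, cancel q hq]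
    exact (measure_mono Set.inter_subset_right).trans (hμν q hq).le
  · intro P hP mP
    rw [hγapp _ (mC.prod mP)]
    have e2 : (fun z : ℝ × ℝ => (((z.1, z.1) : ℝ × ℝ), z)) ⁻¹' (closedHalfPlane ×ˢ P) ∩ D =
        P ∩ D := by
      ext z
      simp [closedHalfPlane]
    have e3 : (fun z : ℝ × ℝ => (z, ((z.1, z.1) : ℝ × ℝ))) ⁻¹' (closedHalfPlane ×ˢ P) ∩ D = ∅ := by
      ext z
      simp only [Set.mem_inter_iff, Set.mem_preimage, Set.mem_prod, Set.mem_empty_iff_false,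
        iff_false, not_and]
      exact fun h => absurd (hP h.2) (lt_irrefl z.1)
    rw [e2, e3, measure_empty, add_zero, ← sum_measure_gridBox hν hκ hK mP]
    congr 1
    refine Finset.sum_congr rfl fun q hq => ?_
    rw [Set.prod_inter_prod, Set.inter_eq_right.2 (hQC q), Measure.prod_prod, hμν q hq,
      mul_comm (ν (Q q)), cancel q hq]
    exact measure_mono Set.inter_subset_right
  · set c := ENNReal.ofReal (2 * L ^ p) with hc
    have mcost : Measurable fun w : (ℝ × ℝ) × (ℝ × ℝ) => ENNReal.ofReal (cost p w.1 w.2) := by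
      unfold cost
      fun_prop
    have hpow : ∀ x ∈ T, ∀ y ∈ T, κ x = κ y → |x - y| ^ p ≤ L ^ p := fun x hx y hy h =>
      Real.rpow_le_rpow (abs_nonneg _) (hL x hx y hy h) (by linarith)
    have bQ : ∀ q, ∀ w ∈ Q q ×ˢ Q q, ENNReal.ofReal (cost p w.1 w.2) ≤ c := by
      rintro q ⟨z, w⟩ ⟨⟨hz, hz1, hz2⟩, hw, hw1, hw2⟩
      refine ENNReal.ofReal_le_ofReal ?_
      have h1 := hpow _ hz.1 _ hw.1 (hz1.trans hw1.symm)
      have h2 := hpow _ hz.2.1 _ hw.2.1 (hz2.trans hw2.symm)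
      simp only [cost] at *
      linarith
    have zp : (0 : ℝ) ^ p = 0 := Real.zero_rpow (by linarith)
    have bD : ∀ z ∈ D, ENNReal.ofReal (cost p z (z.1, z.1)) ≤ c ∧
        ENNReal.ofReal (cost p (z.1, z.1) z) ≤ c := by
      rintro z ⟨hz, hzκ⟩
      have h1 := hpow _ hz.1 _ hz.2.1 hzκ
      have h2 := hpow _ hz.2.1 _ hz.1 hzκ.symm
      have h3 := Real.rpow_nonneg (abs_nonneg (z.1 - z.2)) p
      constructor <;> refine ENNReal.ofReal_le_ofReal ?_ <;>
        simp only [cost, sub_self, abs_zero, zp] <;> linarith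
    rw [hγ, lintegral_add_measure, lintegral_add_measure, lintegral_finsetSum_measure,
      lintegral_map mcost mr, lintegral_map mcost ml]
    have i1 : ∀ q ∈ I, ∫⁻ w, ENNReal.ofReal (cost p w.1 w.2)
        ∂((ν (Q q))⁻¹ • (μ.prod ν).restrict (Q q ×ˢ Q q)) ≤ c * μ (Q q) := by
      intro q hq
      rw [lintegral_smul_measure, smul_eq_mul]
      calc _ ≤ (ν (Q q))⁻¹ * (c * (μ.prod ν) (Q q ×ˢ Q q)) := by
            gcongr
            rw [← setLIntegral_const]
            exact setLIntegral_mono' ((mQ q).prod (mQ q)) (bQ q)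
        _ = c * ((ν (Q q))⁻¹ * (μ (Q q) * ν (Q q))) := by
            rw [Measure.prod_prod]
            ring
        _ = _ := by rw [cancel q hq _ (hμν q hq).le]
    have i2 : ∫⁻ z in D, ENNReal.ofReal (cost p z (z.1, z.1)) ∂μ ≤ c * μ D := by
      rw [← setLIntegral_const]
      exact setLIntegral_mono' mD fun z hz => (bD z hz).1
    have i3 : ∫⁻ z in D, ENNReal.ofReal (cost p (z.1, z.1) z) ∂ν ≤ c * ν D := by
      rw [← setLIntegral_const]
      exact setLIntegral_mono' mD fun z hz => (bD z hz).2
    calc _ ≤ ∑ q ∈ I, c * μ (Q q) + c * μ D + c * ν D :=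
          add_le_add (add_le_add (Finset.sum_le_sum i1) i2) i3
      _ = c * ((∑ q ∈ I, μ (Set.univ ∩ Q q) + μ (Set.univ ∩ D)) + ν D) := by
          simp only [Set.univ_inter]
          rw [← Finset.mul_sum]
          ring
      _ ≤ _ := by
          rw [sum_measure_gridBox hμ hκ hK MeasurableSet.univ]
          gcongr
          exact Set.subset_univ _

end Plans

/-! ### Clusters of critical values -/

section Clusters

/-- From `z`, hop repeatedly to a point less than `η` further until `z'` is reached; each hop uses
up a point of `[z, z')`. -/
theorem sub_le_mul_card {T : Finset ℝ} {η z' : ℝ} (hη : 0 ≤ η) (n : ℕ) :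
    ∀ z ∈ T, z ≤ z' → (T.filter fun x => z ≤ x ∧ x < z').card ≤ n →
      (∀ x ∈ T, z ≤ x → x < z' → ∃ y ∈ T, x < y ∧ y < x + η) → z' - z ≤ η * n := by
  induction n with
  | zero =>
    intro z hz hzz hn _
    rcases hzz.lt_or_eq with h | h
    · have : z ∈ T.filter fun x => z ≤ x ∧ x < z' := by simp [hz, h]
      rw [Finset.card_eq_zero.1 (Nat.le_zero.1 hn)] at this
      simp at this
    · simp [h]
  | succ n ih =>
    intro z hz hzz hn h
    push_cast
    have hn0 : 0 ≤ η * n := by positivity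
    rcases hzz.lt_or_eq with hlt | heq
    · obtain ⟨y, hy, h1, h2⟩ := h z hz le_rfl hlt
      rcases le_or_gt z' y with hy' | hy'
      · linarith
      · have hss : (T.filter fun x => y ≤ x ∧ x < z') ⊂ T.filter fun x => z ≤ x ∧ x < z' := by
          refine (Finset.ssubset_iff_of_subset fun x hx => ?_).2 ⟨z, by simp [hz, hlt], by simp [h1]⟩
          simp only [Finset.mem_filter] at hx ⊢
          exact ⟨hx.1, by linarith, hx.2.2⟩
        have hc := Finset.card_lt_card hss
        have := ih y hy hy'.le (by omega) fun x hx hyx hxz => h x hx (by linarith) hxz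
        linarith
    · rw [heq]
      linarith

/-- The number of elements of `G` that are at most `z`. -/
def cutIndex (G : Finset ℝ) (z : ℝ) : ℕ := (G.filter (· ≤ z)).card

theorem cutIndex_mono (G : Finset ℝ) : Monotone (cutIndex G) := fun x y h =>
  Finset.card_le_card fun g hg => by
    simp only [Finset.mem_filter] at hg ⊢
    exact ⟨hg.1, hg.2.trans h⟩

theorem cutIndex_lt {G : Finset ℝ} {g x y : ℝ} (hg : g ∈ G) (hx : x < g) (hy : g ≤ y) :
    cutIndex G x < cutIndex G y := by
  refine Finset.card_lt_card ((Finset.ssubset_iff_of_subset fun u hu => ?_).2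
    ⟨g, by simp [hg, hy], by simp [hx]⟩)
  simp only [Finset.mem_filter] at hu ⊢
  exact ⟨hu.1, by linarith [hu.2]⟩

/-- The bounds are the last cut up to `z` and the first one beyond it. Half-open fibres are the
shape needed for `diagram_Ico_prod_Ico`. -/
theorem exists_cutIndex_eq_iff {G : Finset ℝ} {z : ℝ} (h1 : ∃ g ∈ G, g ≤ z) (h2 : ∃ g ∈ G, z < g) :
    ∃ a ∈ G, ∃ b ∈ G, a ≤ b ∧ ∀ w, cutIndex G w = cutIndex G z ↔ a ≤ w ∧ w < b := by
  obtain ⟨g₁, hg₁, hz₁⟩ := h1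
  obtain ⟨g₂, hg₂, hz₂⟩ := h2
  obtain ⟨a, ha, hamax⟩ := (G.filter (· ≤ z)).exists_max_image id ⟨g₁, by simp [hg₁, hz₁]⟩
  obtain ⟨b, hb, hbmin⟩ := (G.filter (z < ·)).exists_min_image id ⟨g₂, by simp [hg₂, hz₂]⟩
  simp only [Finset.mem_filter, id] at ha hamax hb hbmin
  refine ⟨a, ha.1, b, hb.1, by linarith [ha.2, hb.2], fun w => ⟨fun h => ⟨?_, ?_⟩, ?_⟩⟩
  · by_contra hw
    exact (cutIndex_lt ha.1 (not_le.1 hw) ha.2).ne h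
  · by_contra hw
    exact (cutIndex_lt hb.1 hb.2 (not_lt.1 hw)).ne h.symm
  · rintro ⟨haw, hwb⟩
    unfold cutIndex
    congr 1
    refine Finset.filter_congr fun g hg => ⟨fun hgw => ?_, fun hgz => (hamax g ⟨hg, hgz⟩).trans haw⟩
    by_contra hgz
    linarith [hbmin g ⟨hg, not_le.1 hgz⟩]

variable (T : Finset ℝ) (ε : ℝ)

/-- The cut points of `T` at scale `ε`: one in each gap of length at least `3ε`, and one below. -/
def cuts : Finset ℝ :=
  insert (-1 - 2 * ε) ((T.filter fun x => ∀ u ∈ T, x < u → x + 3 * ε ≤ u).image (· + ε))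

variable {T ε}

/-- A cut sits `ε` into a gap of length at least `3ε`, leaving `2ε` clear above it: the shift to be
absorbed in `persistentBetti_eq_of_retraction`. -/
theorem cuts_gap (hε : 0 < ε) (h0 : ∀ u ∈ T, 0 ≤ u) {g : ℝ} (hg : g ∈ cuts T ε) :
    ∀ u ∈ T, g ≤ u → g + 2 * ε ≤ u := by
  intro u hu hgu
  rcases Finset.mem_insert.1 hg with rfl | hg
  · linarith [h0 u hu]
  · obtain ⟨x, hx, rfl⟩ := Finset.mem_image.1 hg
    have := (Finset.mem_filter.1 hx).2 u hu (by linarith)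
    linarith

/-- With no cut between them, the two points are joined through `T` by hops shorter than `3ε`. -/
theorem abs_sub_le_of_cutIndex_eq (hε : 0 < ε) {x y : ℝ} (hx : x ∈ T) (hy : y ∈ T)
    (h : cutIndex (cuts T ε) x = cutIndex (cuts T ε) y) : |x - y| ≤ 3 * ε * T.card := by
  wlog hxy : x ≤ y generalizing x y
  · rw [abs_sub_comm]
    exact this hy hx h.symm (le_of_not_ge hxy)
  rw [abs_sub_comm, abs_of_nonneg (by linarith)]
  refine sub_le_mul_card (by linarith) T.card x hx hxy (Finset.card_filter_le _ _) ?_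
  intro u hu hxu huy
  by_contra! hcon
  have hg : u + ε ∈ cuts T ε := Finset.mem_insert_of_mem (Finset.mem_image.2
    ⟨u, Finset.mem_filter.2 ⟨hu, fun v hv huv => hcon v hv huv⟩, rfl⟩)
  have := hcon y hy huy
  exact (cutIndex_lt hg (x := x) (y := y) (by linarith) (by linarith)).ne h

theorem exists_cuts_around (hε : 0 < ε) (h0 : ∀ u ∈ T, 0 ≤ u) {z : ℝ} (hz : z ∈ T) :
    ∃ a ∈ cuts T ε, ∃ b ∈ cuts T ε, a ≤ b ∧
      ∀ w, cutIndex (cuts T ε) w = cutIndex (cuts T ε) z ↔ a ≤ w ∧ w < b := by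
  refine exists_cutIndex_eq_iff ⟨-1 - 2 * ε, Finset.mem_insert_self _ _, by linarith [h0 z hz]⟩ ?_
  -- The largest point of `T` vacuously has a gap above it, so there is a cut beyond all of `T`.
  refine ⟨T.max' ⟨z, hz⟩ + ε, Finset.mem_insert_of_mem (Finset.mem_image.2
    ⟨_, Finset.mem_filter.2 ⟨T.max'_mem _, fun u hu h => ?_⟩, rfl⟩), ?_⟩
  · exact absurd (T.le_max' u hu) (not_le.2 h)
  · linarith [T.le_max' z hz]

end Clusters

/-! ### Stability of diagrams -/

section Stability

variable (F : Type*) [Field F] (d : ℕ) {E : Type*} [MetricSpace E]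

/-- The stability constant of diagrams of subsets of a set of `N` points. -/
def stabilityConst (d : ℕ) (p : ℝ) (N : ℕ) : ℝ :=
  2 * (3 * (N ^ 2 : ℕ)) ^ p * (2 * (((N ^ 2) ^ 2 * (2 * N ^ (d + 1)) : ℕ) : ℝ))

theorem stabilityConst_nonneg (d : ℕ) (p : ℝ) (N : ℕ) : 0 ≤ stabilityConst d p N := by
  unfold stabilityConst
  positivity

/-- A subset `S` of `X` that is `ε`-dense has a diagram at distance `O(ε)` from that of `X`. -/
theorem exists_isPartialPlan_diagram {p : ℝ} (hp : 1 ≤ p) {X : Finset E} {S : Set E}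
    (hSX : S ⊆ X) {ε : ℝ} (hε : 0 < ε) (hdense : ∀ x ∈ X, ∃ y ∈ S, dist y x ≤ ε) :
    ∃ γ, IsPartialPlan (diagram F d S) (diagram F d (X : Set E)) γ ∧
      ∫⁻ w, ENNReal.ofReal (cost p w.1 w.2) ∂γ ≤
        ENNReal.ofReal (stabilityConst d p X.card * ε ^ p) := by
  classical
  set T : Finset ℝ := (X ×ˢ X).image fun z => dist z.1 z.2 with hTdef
  have hTcard : T.card ≤ X.card ^ 2 := by
    rw [sq, ← Finset.card_product]
    exact Finset.card_image_le
  have h0 : ∀ u ∈ T, 0 ≤ u := by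
    intro u hu
    obtain ⟨z, -, rfl⟩ := Finset.mem_image.1 hu
    exact dist_nonneg
  have hTX : ∀ x y : (X : Set E), dist x y ∈ T := fun x y =>
    Finset.mem_image.2 ⟨(x, y), Finset.mem_product.2 ⟨x.2, y.2⟩, rfl⟩
  have hTS : ∀ x y : S, dist x y ∈ T := fun x y =>
    Finset.mem_image.2 ⟨(x, y), Finset.mem_product.2 ⟨hSX x.2, hSX y.2⟩, rfl⟩
  have hSfin : Finite S := (X.finite_toSet.subset hSX).to_subtype
  have hXfin : Finite (X : Set E) := X.finite_toSet.to_subtype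
  choose! ψ hψS hψd using hdense
  let i : S → (X : Set E) := fun s => ⟨s, hSX s.2⟩
  -- Points of `S` are kept fixed, so that `φ` is a retraction.
  let φ : ↥(X : Set E) → S := fun x =>
    if h : (x : E) ∈ S then ⟨x, h⟩ else ⟨ψ x, hψS x x.2⟩
  have hi : Isometry i := Isometry.of_dist_eq fun _ _ => rfl
  have hφ : ∀ s, φ (i s) = s := fun s => by
    have : ((i s : (X : Set E)) : E) ∈ S := s.2
    simp only [φ, this, dif_pos]
    rfl
  have hd : ∀ x, dist (i (φ x)) x ≤ ε := fun x => by
    by_cases h : (x : E) ∈ S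
    · have : i (φ x) = x := by simp only [φ, h, dif_pos, i]
      rw [this, dist_self]
      exact hε.le
    · have : i (φ x) = ⟨ψ x, hSX (hψS x x.2)⟩ := by simp only [φ, h, dif_neg, i, not_false_eq_true]
      rw [this]
      exact hψd x x.2
  set G := cuts T ε with hG
  have hbetti : ∀ s ∈ G, ∀ t ∈ G, s ≤ t →
      persistentBetti F d S s t = persistentBetti F d (X : Set E) s t := by
    intro s hs t ht hst
    have gs := cuts_gap hε h0 hs
    have gt := cuts_gap hε h0 ht
    exact persistentBetti_eq_of_retraction F d hi hφ hε.le hd hst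
      (ripsComplex_eq_of_forall_notMem hTX (by linarith) gs)
      (ripsComplex_eq_of_forall_notMem hTS (by linarith) gs)
      (ripsComplex_eq_of_forall_notMem hTS (by linarith) gt)
  have hμ : diagram F d S (gridPoints T)ᶜ = 0 := diagram_compl F d hTS
  have hν : diagram F d (X : Set E) (gridPoints T)ᶜ = 0 := diagram_compl F d hTX
  have mμ := diagram_univ_le F d hTS
  have mν := diagram_univ_le F d hTX
  have : IsFiniteMeasure (diagram F d S) := ⟨mμ.trans_lt (ENNReal.natCast_lt_top _)⟩
  have : IsFiniteMeasure (diagram F d (X : Set E)) := ⟨mν.trans_lt (ENNReal.natCast_lt_top _)⟩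
  have hbox : ∀ q : ℕ × ℕ, q.1 < q.2 → diagram F d S (gridBox T (cutIndex G) q) =
      diagram F d (X : Set E) (gridBox T (cutIndex G) q) := by
    rintro ⟨k, l⟩ hkl
    rcases (gridBox T (cutIndex G) (k, l)).eq_empty_or_nonempty with he | ⟨z, hz, hz1, hz2⟩
    · rw [he, measure_empty, measure_empty]
    · simp only at hkl hz1 hz2
      subst hz1 hz2
      obtain ⟨a, ha, b, hb, hab, hab'⟩ := exists_cuts_around hε h0 hz.1
      obtain ⟨c, hc, e, he, hce, hce'⟩ := exists_cuts_around hε h0 hz.2.1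
      rw [← hG] at ha hb hc he hab' hce'
      -- The fibres of two different labels are disjoint and ordered like the labels, so the
      -- rectangle lies above the diagonal.
      have hbc : b ≤ c := by
        by_contra! hcb
        have hcz : cutIndex G c = cutIndex G z.2 :=
          (hce' c).2 ⟨le_rfl, ((hce' z.2).1 rfl).1.trans_lt ((hce' z.2).1 rfl).2⟩
        rcases le_or_gt a c with hac | hac
        · rw [← hcz, (hab' c).2 ⟨hac, hcb⟩] at hkl
          exact lt_irrefl _ hkl
        · have haz : cutIndex G a = cutIndex G z.1 :=
            (hab' a).2 ⟨le_rfl, ((hab' z.1).1 rfl).1.trans_lt ((hab' z.1).1 rfl).2⟩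
          rw [← hcz, ← haz] at hkl
          exact hkl.not_ge (cutIndex_mono G hac.le)
      have hset : gridBox T (cutIndex G) (cutIndex G z.1, cutIndex G z.2) =
          (Set.Ico a b ×ˢ Set.Ico c e) ∩ gridPoints T := by
        ext w
        simp only [gridBox, Set.mem_ofPred_eq, hab', hce', Set.mem_inter_iff, Set.mem_prod,
          Set.mem_Ico]
        tauto
      rw [hset, measure_inter_conull hμ, measure_inter_conull hν,
        diagram_Ico_prod_Ico F d hTS hab hbc hce, diagram_Ico_prod_Ico F d hTX hab hbc hce]
      unfold rectangleCount
      rw [hbetti b hb c hc hbc, hbetti a ha c hc (hab.trans hbc), hbetti b hb e he (hbc.trans hce),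
        hbetti a ha e he (hab.trans (hbc.trans hce))]
  obtain ⟨γ, hγ, hcost⟩ := exists_isPartialPlan (p := p) (L := 3 * ε * T.card) hμ hν
    (cutIndex_mono G) (K := G.card + 1) (fun x => Nat.lt_succ_of_le (Finset.card_filter_le _ _)) hp
    (fun x hx y hy h => abs_sub_le_of_cutIndex_eq hε hx hy h) hbox
  refine ⟨γ, hγ, hcost.trans ?_⟩
  -- A bound for both total masses: at most `T.card ^ 2` grid points with `T.card ≤ N ^ 2`, times
  -- the bound on a multiplicity.
  set M : ℕ := (X.card ^ 2) ^ 2 * (2 * X.card ^ (d + 1)) with hM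
  have hcS : Nat.card S ≤ X.card := by
    have := Nat.card_mono X.finite_toSet hSX
    simpa using this
  have hcX : Nat.card (X : Set E) = X.card := by simp
  have mμ' : diagram F d S Set.univ ≤ (M : ℝ≥0∞) := by
    refine mμ.trans (Nat.cast_le.2 ?_)
    rw [hM]
    gcongr
  have mν' : diagram F d (X : Set E) Set.univ ≤ (M : ℝ≥0∞) := by
    refine mν.trans (Nat.cast_le.2 ?_)
    rw [hM, hcX]
    gcongr
  calc _ ≤ ENNReal.ofReal (2 * (3 * ε * (X.card ^ 2 : ℕ)) ^ p) * (M + M) := by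
        gcongr
    _ = ENNReal.ofReal (2 * (3 * ε * (X.card ^ 2 : ℕ)) ^ p) * ENNReal.ofReal (2 * M) := by
        rw [two_mul (M : ℝ), ENNReal.ofReal_add (by positivity) (by positivity),
          ENNReal.ofReal_natCast]
    _ = ENNReal.ofReal (stabilityConst d p X.card * ε ^ p) := by
        rw [← ENNReal.ofReal_mul (by positivity)]
        congr 1
        rw [stabilityConst, ← hM, mul_right_comm 3 ε, Real.mul_rpow (by positivity) hε.le]
        ring

end Stability

/-! ### The covering radius of a random sample -/

section CoveringRadius

variable {M : Type*} [MetricSpace M] {n : ℕ}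

/-- The smallest `r` such that every point is within distance `r` of the sample `s`. -/
def coveringRadius (s : Fin n → M) : ℝ := ⨆ x : M, ⨅ j, dist (s j) x

theorem coveringRadius_nonneg (s : Fin n → M) : 0 ≤ coveringRadius s :=
  Real.iSup_nonneg fun _ => Real.iInf_nonneg fun _ => dist_nonneg

theorem exists_dist_le_coveringRadius [Finite M] (hn : 1 ≤ n) (s : Fin n → M) (x : M) :
    ∃ j, dist (s j) x ≤ coveringRadius s := by
  have : Nonempty (Fin n) := ⟨⟨0, hn⟩⟩
  obtain ⟨j, hj⟩ := exists_eq_ciInf_of_finite (f := fun j => dist (s j) x)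
  exact ⟨j, hj.le.trans (le_ciSup (f := fun x : M => ⨅ j, dist (s j) x)
    (Set.finite_range _).bddAbove x)⟩

theorem exists_lt_dist_of_lt_coveringRadius [Nonempty M] {s : Fin n → M} {r : ℝ}
    (h : r < coveringRadius s) : ∃ x, ∀ j, r < dist (s j) x := by
  obtain ⟨x, hx⟩ := exists_lt_of_lt_ciSup h
  exact ⟨x, fun j => hx.trans_le (ciInf_le (Set.finite_range _).bddBelow j)⟩

variable [Finite M] [MeasurableSpace M] [MeasurableSingletonClass M] {π : Measure M} [IsProbabilityMeasure π]
  {a b r₀ : ℝ}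

theorem measure_compl_ball_le (h : StandardAssumption π a b r₀) (x : M) {r : ℝ} (hr : r₀ < r) :
    π (Metric.ball x r)ᶜ ≤ ENNReal.ofReal (Real.exp (-(a * r ^ b))) := by
  have := h.a_pos
  have hr0 : 0 ≤ r := h.r₀_nonneg.trans hr.le
  rw [prob_compl_eq_one_sub (Set.toFinite _).measurableSet, tsub_le_iff_right]
  refine le_trans ?_ (add_le_add_right (h.le_measure_ball x r hr) _)
  rw [← ENNReal.ofReal_add (by positivity) (by positivity), ← ENNReal.ofReal_one]
  refine ENNReal.ofReal_le_ofReal ?_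
  rcases le_total 1 (a * r ^ b) with h1 | h1
  · rw [min_eq_left h1]
    linarith [Real.exp_pos (-(a * r ^ b))]
  · rw [min_eq_right h1]
    linarith [Real.one_sub_le_exp_neg (a * r ^ b)]

/-- If the radius exceeds `r`, all `n` points miss the ball around some `x`. Sum over `x`, using `1
- min 1 u ≤ exp (-u)` for each draw. -/
theorem measure_lt_coveringRadius_le (h : StandardAssumption π a b r₀) {r : ℝ} (hr : r₀ < r) :
    Measure.pi (fun _ : Fin n => π) {s | r < coveringRadius s} ≤
      ENNReal.ofReal (Nat.card M * Real.exp (-(a * n * r ^ b))) := by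
  have := Fintype.ofFinite M
  have : Nonempty M := nonempty_of_isProbabilityMeasure π
  have hsub : {s : Fin n → M | r < coveringRadius s} ⊆
      ⋃ x : M, Set.univ.pi fun _ : Fin n => (Metric.ball x r)ᶜ := by
    intro s hs
    obtain ⟨x, hx⟩ := exists_lt_dist_of_lt_coveringRadius hs
    refine Set.mem_iUnion.2 ⟨x, fun j _ => ?_⟩
    simpa using (hx j).le
  calc _ ≤ ∑ x : M, Measure.pi (fun _ : Fin n => π) (Set.univ.pi fun _ => (Metric.ball x r)ᶜ) :=
        (measure_mono hsub).trans (measure_iUnion_fintype_le _ _)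
    _ ≤ ∑ x : M, ENNReal.ofReal (Real.exp (-(a * n * r ^ b))) := by
        refine Finset.sum_le_sum fun x _ => ?_
        rw [Measure.pi_pi, Finset.prod_const, Finset.card_univ, Fintype.card_fin]
        refine (pow_le_pow_left₀ zero_le (measure_compl_ball_le h x hr) n).trans_eq ?_
        rw [← ENNReal.ofReal_pow (Real.exp_nonneg _), ← Real.exp_nat_mul]
        congr 2
        ring
    _ = _ := by
        rw [Finset.sum_const, Finset.card_univ, nsmul_eq_mul,
          ENNReal.ofReal_mul (by positivity), ENNReal.ofReal_natCast, Nat.card_eq_fintype_card]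

/-- Layer-cake formula, split at `r₀`. Below, the probability is at most `1`, which gives `r₀ ^ p`.
Above, half of the exponent in the tail is bounded by its value at `r₀` and taken out; the other
half integrates to a Gamma value. -/
theorem lintegral_coveringRadius_rpow_le (h : StandardAssumption π a b r₀) (hn : 1 ≤ n) {p : ℝ}
    (hp : 1 ≤ p) :
    ∫⁻ s, ENNReal.ofReal (coveringRadius s ^ p) ∂Measure.pi (fun _ : Fin n => π) ≤
      ENNReal.ofReal (r₀ ^ p + Nat.card M * (p / b * Real.Gamma (p / b)) * (a * n / 2) ^ (-(p / b))
        * Real.exp (-(a * n * r₀ ^ b) / 2)) := by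
  have ha := h.a_pos
  have hb := h.b_pos
  have hr₀ := h.r₀_nonneg
  have hn0 : (0 : ℝ) < n := by exact_mod_cast hn
  have hΓ : 0 < Real.Gamma (p / b) := Real.Gamma_pos_of_pos (by positivity)
  have hc : 0 < a * n / 2 := by positivity
  set q := Nat.card M * Real.exp (-(a * n * r₀ ^ b) / 2) with hq
  have hq0 : 0 ≤ q := by positivity
  rw [lintegral_rpow_eq_lintegral_meas_lt_mul _
    (Filter.Eventually.of_forall fun s => coveringRadius_nonneg s)
    (measurable_of_countable _).aemeasurable (by linarith)]
  have h1 : ∫⁻ t in Set.Ioc 0 r₀, Measure.pi (fun _ : Fin n => π) {s | t < coveringRadius s} *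
      ENNReal.ofReal (t ^ (p - 1)) ≤ ENNReal.ofReal (r₀ ^ p / p) := by
    have hint : IntervalIntegrable (fun t : ℝ => t ^ (p - 1)) volume 0 r₀ :=
      intervalIntegral.intervalIntegrable_rpow' (by linarith)
    have e : ∫ t in (0 : ℝ)..r₀, t ^ (p - 1) = r₀ ^ p / p := by
      rw [integral_rpow (Or.inl (by linarith))]
      simp [Real.zero_rpow (show p ≠ 0 by linarith)]
    rw [← e, intervalIntegral.integral_of_le hr₀, ofReal_integral_eq_lintegral_ofReal
      ((intervalIntegrable_iff_integrableOn_Ioc_of_le hr₀).1 hint)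
      ((ae_restrict_mem measurableSet_Ioc).mono fun t ht => Real.rpow_nonneg ht.1.le _)]
    exact lintegral_mono fun t => mul_le_of_le_one_left zero_le prob_le_one
  have h2 : ∫⁻ t in Set.Ioi r₀, Measure.pi (fun _ : Fin n => π) {s | t < coveringRadius s} *
      ENNReal.ofReal (t ^ (p - 1)) ≤
      ENNReal.ofReal (q * ((a * n / 2) ^ (-(p / b)) * (1 / b) * Real.Gamma (p / b))) := by
    have hint := integrableOn_rpow_mul_exp_neg_mul_rpow (s := p - 1) (by linarith) hb hc
    have e := integral_rpow_mul_exp_neg_mul_rpow (q := p - 1) hb (by linarith) hc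
    rw [sub_add_cancel, neg_div] at e
    rw [← e, ← integral_const_mul, ofReal_integral_eq_lintegral_ofReal (hint.const_mul q)
      ((ae_restrict_mem measurableSet_Ioi).mono fun t (ht : 0 < t) => by
        simp only [Pi.zero_apply]
        positivity)]
    refine le_trans (setLIntegral_mono' measurableSet_Ioi fun t (ht : r₀ < t) => ?_)
      (lintegral_mono_set (Set.Ioi_subset_Ioi hr₀))
    refine (mul_le_mul_left (measure_lt_coveringRadius_le h ht) _).trans ?_
    have ht0 : 0 < t := hr₀.trans_lt ht
    rw [← ENNReal.ofReal_mul (by positivity)]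
    refine ENNReal.ofReal_le_ofReal ?_
    have hexp : Real.exp (-(a * n * t ^ b)) ≤
        Real.exp (-(a * n * r₀ ^ b) / 2) * Real.exp (-(a * n / 2) * t ^ b) := by
      rw [← Real.exp_add]
      refine Real.exp_le_exp.2 ?_
      have : r₀ ^ b ≤ t ^ b := Real.rpow_le_rpow hr₀ ht.le hb.le
      nlinarith [mul_le_mul_of_nonneg_left this hc.le]
    calc _ ≤ Nat.card M * (Real.exp (-(a * n * r₀ ^ b) / 2) * Real.exp (-(a * n / 2) * t ^ b)) *
          t ^ (p - 1) := by gcongr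
      _ = _ := by
        rw [hq]
        ring
  rw [← Set.Ioc_union_Ioi_eq_Ioi hr₀]
  refine (mul_le_mul_right ((lintegral_union_le _ _ _).trans (add_le_add h1 h2)) _).trans ?_
  rw [← ENNReal.ofReal_add (by positivity) (by positivity), ← ENNReal.ofReal_mul (by linarith)]
  refine ENNReal.ofReal_le_ofReal (le_of_eq ?_)
  rw [hq]
  field_simp

end CoveringRadius

/-! ### The approximation error -/

section ApproximationError

/-- Stability at each sample's covering radius, with the plans averaged. The radius may vanish while
stability needs `ε > 0`, so `δ` is added and then sent to `0`. -/
theorem OT_meanMeasure_rpow_le (F : Type*) [Field F] (d : ℕ) {p : ℝ} (hp : 1 ≤ p) {E : Type*}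
    [MetricSpace E] (X : Finset E) {B n : ℕ} (hn : 1 ≤ n) (hB : 1 ≤ B) (S : Fin B → Fin n → X) :
    OT p (meanMeasure F d fun i j => (S i j : E)) (diagram F d (X : Set E)) ^ p ≤
      (B : ℝ≥0∞)⁻¹ * ∑ i, ENNReal.ofReal (stabilityConst d p X.card * coveringRadius (S i) ^ p) := by
  have key : ∀ δ : ℝ, 0 < δ →
      OT p (meanMeasure F d fun i j => (S i j : E)) (diagram F d (X : Set E)) ^ p ≤ (B : ℝ≥0∞)⁻¹ *
        ∑ i, ENNReal.ofReal (stabilityConst d p X.card * (coveringRadius (S i) + δ) ^ p) := by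
    intro δ hδ
    have hex := fun i => exists_isPartialPlan_diagram F d hp (X := X)
      (S := Set.range fun j => (S i j : E)) (by rintro _ ⟨j, rfl⟩; exact (S i j).2)
      (ε := coveringRadius (S i) + δ) (by linarith [coveringRadius_nonneg (S i)])
      (fun x hx => by
        obtain ⟨j, hj⟩ := exists_dist_le_coveringRadius hn (S i) ⟨x, hx⟩
        exact ⟨_, ⟨j, rfl⟩, le_trans hj (by linarith)⟩)
    choose γ hγ hcost using hex
    refine (OT_rpow_le hp (IsPartialPlan.mean hB hγ)).trans ?_
    rw [lintegral_smul_measure, lintegral_finsetSum_measure, smul_eq_mul]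
    gcongr with i
    exact hcost i
  have hB0 : (B : ℝ≥0∞) ≠ 0 := by exact_mod_cast (by omega : B ≠ 0)
  have hlim : Filter.Tendsto (fun δ : ℝ => (B : ℝ≥0∞)⁻¹ *
      ∑ i, ENNReal.ofReal (stabilityConst d p X.card * (coveringRadius (S i) + δ) ^ p))
      (nhdsWithin 0 (Set.Ioi 0)) (nhds ((B : ℝ≥0∞)⁻¹ *
      ∑ i, ENNReal.ofReal (stabilityConst d p X.card * coveringRadius (S i) ^ p))) := by
    refine ENNReal.Tendsto.const_mul (tendsto_finsetSum _ fun i _ => ?_)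
      (Or.inr (ENNReal.inv_ne_top.2 hB0))
    refine ENNReal.tendsto_ofReal ?_
    have : Filter.Tendsto (fun δ : ℝ => stabilityConst d p X.card * (coveringRadius (S i) + δ) ^ p)
        (nhds 0) (nhds (stabilityConst d p X.card * (coveringRadius (S i) + 0) ^ p)) :=
      ((tendsto_const_nhds.add Filter.tendsto_id).rpow_const (Or.inr (by linarith))).const_mul _
    rw [add_zero] at this
    exact this.mono_left nhdsWithin_le_nhds
  exact ge_of_tendsto hlim (by filter_upwards [self_mem_nhdsWithin] with δ hδ using key δ hδ)

theorem approximationError_le (F : Type*) [Field F] (d : ℕ) {p : ℝ} (hp : 1 ≤ p) {E : Type*}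
    [MetricSpace E] [MeasurableSpace E] [MeasurableSingletonClass E] (X : Finset E) {a b r₀ : ℝ}
    {π : Measure X} [IsProbabilityMeasure π] (h : StandardAssumption π a b r₀) {B n : ℕ}
    (hn : 1 ≤ n) (hB : 1 ≤ B) {Ω : Type*} [MeasurableSpace Ω] {P : Measure Ω}
    {S : Fin B → Ω → Fin n → X} (hS : ∀ i, HasLaw (S i) (Measure.pi fun _ : Fin n => π) P) :
    approximationError F d p X P S ≤ ENNReal.ofReal (stabilityConst d p X.card *
      (r₀ ^ p + X.card * (p / b * Real.Gamma (p / b)) * (a * n / 2) ^ (-(p / b))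
        * Real.exp (-(a * n * r₀ ^ b) / 2))) := by
  have hC := stabilityConst_nonneg d p X.card
  have hB0 : (B : ℝ≥0∞) ≠ 0 := by exact_mod_cast (by omega : B ≠ 0)
  have hmom := lintegral_coveringRadius_rpow_le h hn hp
  rw [Nat.card_eq_fintype_card, Fintype.card_coe] at hmom
  set f : (Fin n → X) → ℝ≥0∞ := fun s =>
    ENNReal.ofReal (stabilityConst d p X.card * coveringRadius s ^ p) with hf
  have hfm : Measurable f := measurable_of_countable f
  have hone : ∀ i, ∫⁻ ω, f (S i ω) ∂P ≤ ENNReal.ofReal (stabilityConst d p X.card *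
      (r₀ ^ p + X.card * (p / b * Real.Gamma (p / b)) * (a * n / 2) ^ (-(p / b))
        * Real.exp (-(a * n * r₀ ^ b) / 2))) := by
    intro i
    rw [← lintegral_map' (f := f) hfm.aemeasurable (hS i).aemeasurable, (hS i).map_eq,
      ENNReal.ofReal_mul hC, hf]
    simp only [ENNReal.ofReal_mul hC]
    rw [lintegral_const_mul _ (measurable_of_countable _)]
    gcongr
  calc approximationError F d p X P S ≤ ∫⁻ ω, (B : ℝ≥0∞)⁻¹ * ∑ i, f (S i ω) ∂P :=
        lintegral_mono fun ω => OT_meanMeasure_rpow_le F d hp X hn hB fun i => S i ω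
    _ = (B : ℝ≥0∞)⁻¹ * ∑ i, ∫⁻ ω, f (S i ω) ∂P := by
        rw [lintegral_const_mul' _ _ (ENNReal.inv_ne_top.2 hB0), lintegral_finsetSum']
        exact fun i _ => hfm.comp_aemeasurable (hS i).aemeasurable
    _ ≤ (B : ℝ≥0∞)⁻¹ * ∑ i : Fin B, ENNReal.ofReal (stabilityConst d p X.card *
      (r₀ ^ p + X.card * (p / b * Real.Gamma (p / b)) * (a * n / 2) ^ (-(p / b))
        * Real.exp (-(a * n * r₀ ^ b) / 2))) := by
        gcongr with i
        exact hone i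
    _ = _ := by
        rw [Finset.sum_const, Finset.card_univ, Fintype.card_fin, nsmul_eq_mul, ← mul_assoc,
          ENNReal.inv_mul_cancel hB0 (ENNReal.natCast_ne_top B), one_mul]

end ApproximationError

/-! ### Comparison of rates -/

section Rates

/-- The exponent drops from `p / b` to `1 / b` because `p ≥ 1`; the logarithm is paid for by `log x
/ log 2 ≥ 1`. -/
theorem rpow_neg_le_log_div_rpow {b p x : ℝ} (hp : 1 ≤ p) (hb : 0 < b) (hx : 2 ≤ x) :
    x ^ (-(p / b)) ≤ Real.log 2 ^ (-(1 / b)) * (Real.log x / x) ^ (1 / b) := by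
  have hl2 : 0 < Real.log 2 := Real.log_pos one_lt_two
  have hlx : Real.log 2 ≤ Real.log x := Real.log_le_log two_pos hx
  have h1 : x ^ (-(p / b)) ≤ x ^ (-(1 / b)) :=
    Real.rpow_le_rpow_of_exponent_le (by linarith) (by gcongr)
  have h2 : Real.log 2 ^ (1 / b) ≤ Real.log x ^ (1 / b) := by gcongr
  have h3 : 0 < Real.log 2 ^ (1 / b) := by positivity
  rw [Real.div_rpow (by linarith) (by linarith), Real.rpow_neg hl2.le]
  refine h1.trans ?_
  rw [Real.rpow_neg (by linarith), ← mul_div_assoc, inv_eq_one_div (x ^ (1 / b))]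
  gcongr
  rw [inv_mul_eq_div, one_le_div h3]
  exact h2

/-- The surplus `x ^ (-1/2)` beats `(log x)⁻²`: squaring `log x ≤ 4 x ^ (1/4)` gives the `16`. -/
theorem rpow_neg_mul_le_log_div_rpow {b p x : ℝ} (hp : 1 ≤ p) (hb : 0 < b) (hx : 2 ≤ x) :
    x ^ (-(p / b)) * x ^ (-(1 / 2) : ℝ) ≤
      16 * Real.log 2 ^ (-(p / b)) * ((Real.log x / x) ^ (p / b) * (1 / Real.log x ^ 2)) := by
  have hl2 : 0 < Real.log 2 := Real.log_pos one_lt_two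
  have hlx : Real.log 2 ≤ Real.log x := Real.log_le_log two_pos hx
  have hl : 0 < Real.log x := by linarith
  have hx0 : 0 < x := by linarith
  have h1 : Real.log 2 ^ (p / b) ≤ Real.log x ^ (p / b) := by gcongr
  have h2 : 0 < Real.log 2 ^ (p / b) := by positivity
  have h3 : Real.log x ^ 2 ≤ 16 * x ^ (1 / 2 : ℝ) := by
    have := Real.log_le_rpow_div hx0.le (ε := 1 / 4) (by norm_num)
    have h4 : (x ^ (1 / 4 : ℝ)) ^ 2 = x ^ (1 / 2 : ℝ) := by
      rw [← Real.rpow_natCast, ← Real.rpow_mul hx0.le]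
      norm_num
    calc Real.log x ^ 2 ≤ (x ^ (1 / 4 : ℝ) / (1 / 4)) ^ 2 := by gcongr
      _ = 16 * x ^ (1 / 2 : ℝ) := by
        rw [div_pow, h4]
        ring
  have h5 : x ^ (-(1 / 2) : ℝ) ≤ 16 * (1 / Real.log x ^ 2) := by
    rw [Real.rpow_neg hx0.le, mul_one_div, inv_le_comm₀ (by positivity) (by positivity), inv_div,
      div_le_iff₀ (by norm_num)]
    linarith
  have h6 : x ^ (-(p / b)) ≤ Real.log 2 ^ (-(p / b)) * (Real.log x / x) ^ (p / b) := by
    rw [Real.div_rpow hl.le hx0.le, Real.rpow_neg hl2.le, Real.rpow_neg hx0.le, ← mul_div_assoc,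
      inv_eq_one_div (x ^ (p / b))]
    gcongr
    rw [inv_mul_eq_div, one_le_div h2]
    exact h1
  calc _ ≤ (Real.log 2 ^ (-(p / b)) * (Real.log x / x) ^ (p / b)) * (16 * (1 / Real.log x ^ 2)) := by
        gcongr
    _ = _ := by ring

end Rates

end MeanPersistence

end

/-- The term `C₁ B ^ (-1/2)` is not needed: since `OT_p ^ p` is convex in its first argument, the
error of the mean measure is at most that of a single sample, for every `B`. -/
theorem theorem4p3 {F : Type*} [Field F] (d : ℕ) (p : ℝ) (hp : 1 ≤ p) (N : ℕ) :
    ∃ (C₂ : ℝ) (C₃ : ℝ → ℝ → ℝ),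
      ∀ (m : ℕ) (X : Finset (EuclideanSpace ℝ (Fin m))), X.card = N →
        ∃ C₁ : ℝ, ∀ (a b r₀ : ℝ) (π : Measure X) [IsProbabilityMeasure π],
          MeanPersistence.StandardAssumption π a b r₀ →
          ∀ (n B : ℕ), 1 ≤ n → 1 ≤ B →
          ∀ {Ω : Type*} [MeasurableSpace Ω] (P : Measure Ω) [IsProbabilityMeasure P]
            (S : Fin B → Ω → Fin n → X), iIndepFun S P →
            (∀ i, HasLaw (S i) (Measure.pi fun _ : Fin n => π) P) →
            (b < p →
              MeanPersistence.approximationError F d p X P S ≤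
                ENNReal.ofReal (C₁ * (B : ℝ) ^ (-(1 / 2) : ℝ) + C₂ * r₀ ^ p
                  + C₃ a b * (n : ℝ) ^ (-(p / b - 1)))) ∧
            (p ≤ b → 2 ≤ n → r₀ < (Real.log n / (a * n)) ^ (1 / b) →
              MeanPersistence.approximationError F d p X P S ≤
                ENNReal.ofReal (C₁ * (B : ℝ) ^ (-(1 / 2) : ℝ) + C₂ * r₀ ^ p
                  + C₃ a b * (Real.log n / n) ^ (1 / b))) ∧
            (p ≤ b → 2 ≤ n → (Real.log n / (a * n)) ^ (1 / b) ≤ r₀ →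
              MeanPersistence.approximationError F d p X P S ≤
                ENNReal.ofReal (C₁ * (B : ℝ) ^ (-(1 / 2) : ℝ) + C₂ * r₀ ^ p
                  + C₃ a b * ((Real.log n / n) ^ (p / b) * (1 / Real.log n ^ 2)))) := by
  classical
  set C := MeanPersistence.stabilityConst d p N with hC
  have hC0 : 0 ≤ C := MeanPersistence.stabilityConst_nonneg d p N
  -- The last factor adds the constants of the three regimes, so that one `C₃` serves them all.
  refine ⟨C, fun a b => C * (N * (p / b * Real.Gamma (p / b)) * (a / 2) ^ (-(p / b))) *
    (1 + Real.log 2 ^ (-(1 / b)) + 16 * Real.log 2 ^ (-(p / b))), fun m X hX => ⟨0, ?_⟩⟩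
  intro a b r₀ π _ hπ n B hn hB Ω _ P _ S _ hS
  have ha := hπ.a_pos
  have hb := hπ.b_pos
  have hr₀ := hπ.r₀_nonneg
  have hn1 : (1 : ℝ) ≤ n := by exact_mod_cast hn
  have hl2 : 0 < Real.log 2 := Real.log_pos one_lt_two
  have hΓ : 0 < Real.Gamma (p / b) := Real.Gamma_pos_of_pos (by positivity)
  have herr := MeanPersistence.approximationError_le F d hp X hπ hn hB hS
  rw [hX, ← hC, show a * n / 2 = a / 2 * n by ring,
    Real.mul_rpow (by positivity) (by positivity)] at herr
  set A := N * (p / b * Real.Gamma (p / b)) * (a / 2) ^ (-(p / b)) with hA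
  have hA0 : 0 ≤ A := by positivity
  set k := Real.log 2 ^ (-(1 / b)) with hk
  set l := Real.log 2 ^ (-(p / b)) with hl
  have hk0 : 0 ≤ k := by positivity
  have hl0 : 0 ≤ l := by positivity
  set e := Real.exp (-(a * n * r₀ ^ b) / 2) with he
  have he0 : 0 < e := Real.exp_pos _
  have he1 : e ≤ 1 := Real.exp_le_one_iff.2 (by
    have : 0 ≤ a * n * r₀ ^ b := by positivity
    linarith)
  have reduce : ∀ ρ : ℝ, (n : ℝ) ^ (-(p / b)) * e ≤ (1 + k + 16 * l) * ρ →
      MeanPersistence.approximationError F d p X P S ≤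
        ENNReal.ofReal (0 * (B : ℝ) ^ (-(1 / 2) : ℝ) + C * r₀ ^ p + C * A * (1 + k + 16 * l) * ρ) := by
    intro ρ h
    refine herr.trans (ENNReal.ofReal_le_ofReal ?_)
    have := mul_le_mul_of_nonneg_left h (mul_nonneg hC0 hA0)
    calc _ = C * r₀ ^ p + C * A * ((n : ℝ) ^ (-(p / b)) * e) := by
          rw [hA]
          ring
      _ ≤ _ := by linarith
  have hpow0 : 0 ≤ (n : ℝ) ^ (-(p / b)) := by positivity
  refine ⟨fun hbp => reduce _ ?_, fun hpb hn2 _ => reduce _ ?_,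
    fun hpb hn2 hr => reduce _ ?_⟩
  · have h1 : (n : ℝ) ^ (-(p / b)) ≤ (n : ℝ) ^ (-(p / b - 1)) :=
      Real.rpow_le_rpow_of_exponent_le hn1 (by linarith)
    have h2 : 0 ≤ (n : ℝ) ^ (-(p / b - 1)) := by positivity
    calc _ ≤ (n : ℝ) ^ (-(p / b)) := mul_le_of_le_one_right hpow0 he1
      _ ≤ 1 * (n : ℝ) ^ (-(p / b - 1)) := by rwa [one_mul]
      _ ≤ _ := by
        gcongr
        linarith
  · have hlog := Real.log_nonneg hn1
    have h1 := MeanPersistence.rpow_neg_le_log_div_rpow hp hb (x := n) (by exact_mod_cast hn2)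
    calc _ ≤ (n : ℝ) ^ (-(p / b)) := mul_le_of_le_one_right hpow0 he1
      _ ≤ k * (Real.log n / n) ^ (1 / b) := h1
      _ ≤ _ := by
        gcongr
        linarith
  · have hlog := Real.log_nonneg hn1
    have h1 := MeanPersistence.rpow_neg_mul_le_log_div_rpow hp hb (x := n) (by exact_mod_cast hn2)
    -- In this regime `a n r₀ ^ b ≥ log n`, and half of that is the exponent in `e`.
    have h2 : e ≤ (n : ℝ) ^ (-(1 / 2) : ℝ) := by
      rw [he, Real.rpow_def_of_pos (x := (n : ℝ)) (by linarith)]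
      refine Real.exp_le_exp.2 ?_
      have h3 : Real.log n / (a * n) ≤ r₀ ^ b := by
        have := Real.rpow_le_rpow (by positivity) hr hb.le
        rwa [← Real.rpow_mul (by positivity), one_div_mul_cancel hb.ne', Real.rpow_one] at this
      rw [div_le_iff₀ (by positivity)] at h3
      linarith
    calc _ ≤ (n : ℝ) ^ (-(p / b)) * (n : ℝ) ^ (-(1 / 2) : ℝ) := by gcongr
      _ ≤ 16 * l * ((Real.log n / n) ^ (p / b) * (1 / Real.log n ^ 2)) := h1
      _ ≤ _ := by
        gcongr
        linarith
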